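/- Let $(\Omega,\mathcal F,\mathbf P)$ be a probability space and $\mathcal G\subset\mathcal F$ a sub-$\sigma$-algebra. Let $\beta\in\mathbb R$ and let $\gamma$ be a $\sigma$-finite measure on $(0,\infty)$ with $\int_0^\infty (z\wedge z^2)\,\gamma(dz)<\infty$. Let $\xi\ge 0$ be a $\mathcal G$-measurable real random variable and let $Z$ be a real random variable such that, for every $\lambda\ge 0$, almost surely $$\mathbf E\big(e^{-\lambda Z}\,\big|\,\mathcal G\big)=\exp\Big\{\xi\Big[\beta\lambda+\int_0^\infty (e^{-\lambda z}-1+\lambda z)\,\gamma(dz)\Big]\Big\},$$ where the left-hand side is the conditional expectation of a nonnegative random variable (which need not be integrable). Then there is an extension of the probability space, of the form $\tilde\Omega=\Omega\times S$ with $S$ a measurable space and $\tilde{\mathbf P}(d\omega,ds)=\mathbf P(d\omega)\,\kappa(\omega,ds)$ for a probability kernel $\kappa$ from $\Omega$ to $S$ (random variables on $\Omega$ and $\mathcal G$ being lifted through the projection $\tilde\Omega\to\Omega$), on which there exists a Poisson random measure $N(dz,du)$ on $(0,\infty)^2$ with intensity $\gamma(dz)\,du$ such that $N$ is independent of $\mathcal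 G$ and, $\tilde{\mathbf P}$-almost surely, $$Z=-\beta\xi+\int_0^\infty\!\!\int_0^{\xi} z\,\tilde N(dz,du).$$ Here $\tilde N=N-\gamma(dz)\,du$ is the compensated measure, and the stochastic integral is the limit in probability, as $\varepsilon\downarrow 0$, of $\int_{(\varepsilon,\infty)}\int_0^\xi z\,N(dz,du)-\int_{(\varepsilon,\infty)}\int_0^\xi z\,\gamma(dz)\,du$, in which for each $\varepsilon>0$ both integrals are almost surely finite; that the integral exists in this sense is part of the claim. -/

import Mathlib

open MeasureTheory ProbabilityTheory Set Filter Topology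
open scoped ENNReal

/-- `N` is a Poisson random measure on `E` with (σ-finite) intensity `μ`, under the probability
measure `P`: it is a measurable map into the space of measures on `E` (with the σ-algebra
generated by the evaluations `ν ↦ ν B`), `N(B)` is Poisson distributed with parameter `μ B`
whenever `μ B < ∞`, and `N(B₁), …, N(Bₙ)` are independent for disjoint `B₁, …, Bₙ` of finite
intensity. -/
structure IsPoissonRandomMeasure {Ω E : Type*} [MeasurableSpace Ω] [MeasurableSpace E]
    (P : Measure Ω) (N : Ω → Measure E) (μ : Measure E) : Prop where
  measurable : Measurable N
  hasLaw : ∀ B : Set E, MeasurableSet B → μ B < ∞ →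
    HasLaw (fun ω => N ω B) ((poissonMeasure (μ B).toNNReal).map (Nat.cast : ℕ → ℝ≥0∞)) P
  indep : ∀ (n : ℕ) (B : Fin n → Set E), (∀ i, MeasurableSet (B i)) → (∀ i, μ (B i) < ∞) →
    Pairwise (fun i j => Disjoint (B i) (B j)) → iIndepFun (fun i ω => N ω (B i)) P

/-- The integral over `{|H| > ε}` of the (possibly random) integrand `H` against the compensated
measure `N - μ`. -/
noncomputable def truncatedCompensatedIntegral {Ω E : Type*} [MeasurableSpace E]
    (N : Ω → Measure E) (μ : Measure E) (H : Ω → E → ℝ) (ε : ℝ) (ω : Ω) : ℝ :=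
  (∫ x in {x | ε < |H ω x|}, H ω x ∂(N ω)) - ∫ x in {x | ε < |H ω x|}, H ω x ∂μ

/-- `I` is the stochastic integral `∫ H dÑ` of `H` with respect to the compensated measure
`Ñ = N - μ`. For every `ε > 0` the part `{|H| > ε}` is a.s. absolutely integrable for both `N`
and `μ`, and the truncated compensated integrals converge to `I` in probability as `ε ↓ 0`.
(This determines `I` up to a null set.) -/
structure IsCompensatedIntegral {Ω E : Type*} [MeasurableSpace Ω] [MeasurableSpace E]
    (P : Measure Ω) (N : Ω → Measure E) (μ : Measure E) (H : Ω → E → ℝ) (I : Ω → ℝ) : Prop where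
  integrable : ∀ ε : ℝ, 0 < ε → ∀ᵐ ω ∂P,
    IntegrableOn (H ω) {x | ε < |H ω x|} (N ω) ∧ IntegrableOn (H ω) {x | ε < |H ω x|} μ
  tendsto : TendstoInMeasure P (truncatedCompensatedIntegral N μ H) (𝓝[>] (0 : ℝ)) I

/-- Lebesgue measure `du` on `(0, ∞)`. -/
noncomputable def lebesguePos : Measure (Ioi (0 : ℝ)) := volume.comap Subtype.val

instance : SigmaFinite lebesguePos := by
  unfold lebesguePos
  refine ⟨⟨⟨fun n => {x | (x : ℝ) ≤ n}, by simp, fun n => ?_, ?_⟩⟩⟩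
  · rw [comap_subtype_coe_apply measurableSet_Ioi]
    have : ((↑) '' {x : Ioi (0 : ℝ) | (x : ℝ) ≤ n} : Set ℝ) = Ioc 0 (n : ℝ) := by
      ext x; simp [and_comm]
    rw [this]; simp
  · ext x; simpa using exists_nat_ge (x : ℝ)

/-!
The idea is to build a Poisson random measure from scratch and then to couple it with `Z`.

On a standard Borel space `S` with a probability measure `Q`, a Poisson random measure `N` of
intensity `γ(dz) du` is realised as a superposition of independent finite Poisson samples
(`pointMeasure`, `poissonLaw`). Everything about it follows from its exponential functional
`E exp (c ∫ f dN) = exp ∫ (e^{cf} - 1)` for integrable `f` (`integral_exp_pointMeasure`): with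
imaginary `c` it yields the Poisson laws and the independence of the counts, with real `c` the
Laplace transforms of compensated integrals.

For a fixed height `x`, the compensated integral of `z` over the jumps `z ∈ D`, `u ≤ x` is a
variable `J` with `E e^{-lJ} = exp (x ∫_D h(lz) γ(dz))`, where `h(y) = e^{-y} - 1 + y`. Since
`E J = 0`, it also satisfies `E h(J) = exp (x ∫_D h dγ) - 1`. This is small when `D` consists of
small jumps and, `h` being nonnegative with a zero only at `0`, it takes the part of a second moment
in a Chebyshev inequality. Hence the truncated integrals converge as the truncation is removed, to a
limit `W (x, s)` that is jointly measurable in `x` and `s ∈ S`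
(`exists_compensatedJumpIntegral`).

By hypothesis `Z` has, given `G`, the same Laplace transform on `[0, ∞)` as
`V (x, ·) = -β x + W (x, ·)` at `x = ξ`. A finite measure on the line is determined by such a
one-sided transform, so that the joint law of `ξ` and `Z` on any event of `G` is that of `ξ` and
`V (ξ, ·)`, with an independent sample from `Q`. It remains to disintegrate: `Q` has, for every `x`,
a conditional law given `V (x, ·) = z`, measurable in `(x, z)`, and the extension draws the point of
`S` from this law at `x = ξ`, `z = Z` (`exists_kernel_compProd_eq`). The point drawn has law `Q`, is
independent of `G`, and satisfies `Z = V (ξ, ·)`.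
-/

open scoped NNReal

/-! ### Uniqueness of one-sided Laplace transforms -/

/-- A finite measure on the line is determined by its Laplace transform on `[0, ∞)`, as soon as
the latter is finite: it extends analytically to the half-plane of positive real part, and on a
vertical line there it is the characteristic function of the exponentially tilted measure. -/
theorem MeasureTheory.Measure.ext_of_lintegral_exp_neg_eq {m₁ m₂ : Measure ℝ}
    [IsFiniteMeasure m₁] [IsFiniteMeasure m₂]
    (hfin : ∀ l : ℝ, 0 ≤ l → ∫⁻ z, ENNReal.ofReal (Real.exp (-l * z)) ∂m₁ ≠ ∞)
    (h : ∀ l : ℝ, 0 ≤ l → ∫⁻ z, ENNReal.ofReal (Real.exp (-l * z)) ∂m₁ =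
      ∫⁻ z, ENNReal.ofReal (Real.exp (-l * z)) ∂m₂) : m₁ = m₂ := by
  have hfin₂ : ∀ l : ℝ, 0 ≤ l → ∫⁻ z, ENNReal.ofReal (Real.exp (-l * z)) ∂m₂ ≠ ∞ :=
    fun l hl => h l hl ▸ hfin l hl
  have hint : ∀ m : Measure ℝ, (∀ l : ℝ, 0 ≤ l →
      ∫⁻ z, ENNReal.ofReal (Real.exp (-l * z)) ∂m ≠ ∞) → Iic 0 ⊆ integrableExpSet id m := by
    intro m hm t ht
    have := hm (-t) (by simpa using ht)
    simp only [neg_neg] at this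
    exact (lintegral_ofReal_ne_top_iff_integrable (by fun_prop)
      (ae_of_all _ fun z => (Real.exp_pos _).le)).1 this
  have hsub : ∀ m : Measure ℝ, (∀ l : ℝ, 0 ≤ l →
      ∫⁻ z, ENNReal.ofReal (Real.exp (-l * z)) ∂m ≠ ∞) →
      AnalyticOnNhd ℂ (complexMGF id m) {z | z.re < 0} := fun m hm =>
    analyticOnNhd_complexMGF.mono fun z hz => by
      have := interior_mono (hint m hm)
      rw [interior_Iic] at this
      exact this hz
  have hpre : IsPreconnected {z : ℂ | z.re < 0} :=
    (convex_halfSpace_re_lt 0).isPreconnected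
  have heq : EqOn (complexMGF id m₁) (complexMGF id m₂) {z | z.re < 0} := by
    refine AnalyticOnNhd.eqOn_of_preconnected_of_frequently_eq (hsub m₁ hfin) (hsub m₂ hfin₂)
      hpre (z₀ := ((-1 : ℝ) : ℂ)) (by simp) ?_
    have h_real : ∃ᶠ x : ℝ in 𝓝[≠] (-1 : ℝ), complexMGF id m₁ x = complexMGF id m₂ x := by
      refine Eventually.frequently (eventually_nhdsWithin_of_eventually_nhds ?_)
      filter_upwards [gt_mem_nhds (show (-1 : ℝ) < 0 by norm_num)] with x hx
      have hmgf : mgf id m₁ x = mgf id m₂ x := by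
        have := h (-x) (by linarith)
        simp only [neg_neg] at this
        rw [mgf, mgf, integral_eq_lintegral_of_nonneg_ae (ae_of_all _ fun z => (Real.exp_pos _).le)
          (by fun_prop), integral_eq_lintegral_of_nonneg_ae
          (ae_of_all _ fun z => (Real.exp_pos _).le) (by fun_prop)]
        simpa using congrArg ENNReal.toReal this
      rw [complexMGF_ofReal, complexMGF_ofReal, hmgf]
    rw [frequently_iff_seq_forall] at h_real ⊢
    obtain ⟨xs, hx, hxe⟩ := h_real
    refine ⟨fun n => xs n, ?_, fun n => hxe n⟩
    rw [tendsto_nhdsWithin_iff] at hx ⊢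
    exact ⟨Complex.continuous_ofReal.tendsto _ |>.comp hx.1,
      hx.2.mono fun n hn hxn => hn (Complex.ofReal_injective hxn)⟩
  -- on the line of real part `-1`, `complexMGF` is the characteristic function of `e^{-z} m(dz)`
  let e : ℝ → ℝ≥0∞ := fun z => ENNReal.ofReal (Real.exp (-z))
  have he : Measurable e := by fun_prop
  have hem : ∀ m : Measure ℝ, (∀ l : ℝ, 0 ≤ l →
      ∫⁻ z, ENNReal.ofReal (Real.exp (-l * z)) ∂m ≠ ∞) → IsFiniteMeasure (m.withDensity e) := by
    intro m hm
    exact isFiniteMeasure_withDensity (by simpa [e] using hm 1 zero_le_one)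
  have := hem m₁ hfin
  have := hem m₂ hfin₂
  have hchar : ∀ (m : Measure ℝ) (t : ℝ),
      charFun (m.withDensity e) t = complexMGF id m (-1 + t * Complex.I) := by
    intro m t
    rw [charFun_apply_real, complexMGF, integral_withDensity_eq_integral_toReal_smul he
      (ae_of_all _ fun z => ENNReal.ofReal_lt_top)]
    refine integral_congr_ae (ae_of_all _ fun z => ?_)
    simp only [e, id, ENNReal.toReal_ofReal (Real.exp_pos _).le, Complex.real_smul,
      Complex.ofReal_exp, ← Complex.exp_add]
    congr 1
    push_cast
    ring
  have htilt : m₁.withDensity e = m₂.withDensity e :=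
    Measure.ext_of_charFun (funext fun t => by
      rw [hchar, hchar]; exact heq (by simp))
  have hinv : ∀ m : Measure ℝ,
      (m.withDensity e).withDensity (fun z => ENNReal.ofReal (Real.exp z)) = m := by
    intro m
    rw [← withDensity_mul _ he (by fun_prop)]
    convert withDensity_one
    ext z
    simp [e, ← ENNReal.ofReal_mul (Real.exp_pos _).le, ← Real.exp_add]
  rw [← hinv m₁, htilt, hinv]

/-! ### Finitely many Poisson points -/

theorem lintegral_natCast_poissonMeasure (r : ℝ≥0) :
    ∫⁻ n, (n : ℝ≥0∞) ∂(poissonMeasure r) = r := by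
  have key : ∀ n : ℕ, ENNReal.ofReal (Real.exp (-r) * r ^ (n + 1) / (n + 1).factorial) *
      ((n + 1 : ℕ) : ℝ≥0∞) = r * ENNReal.ofReal (Real.exp (-r) * r ^ n / n.factorial) := by
    intro n
    rw [← ENNReal.ofReal_natCast, ← ENNReal.ofReal_mul (by positivity), ← ENNReal.ofReal_coe_nnreal,
      ← ENNReal.ofReal_mul (by positivity), Nat.factorial_succ]
    congr 1
    push_cast
    field_simp
    ring
  have h1 : ∑' n : ℕ, ENNReal.ofReal (Real.exp (-r) * r ^ n / n.factorial) = 1 := by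
    have h := measure_univ (μ := poissonMeasure r)
    rw [poissonMeasure, Measure.sum_apply _ MeasurableSet.univ] at h
    simpa using h
  rw [poissonMeasure, lintegral_sum_measure]
  simp only [lintegral_smul_measure, lintegral_dirac, smul_eq_mul]
  rw [tsum_eq_zero_add' ENNReal.summable]
  simp only [key, ENNReal.tsum_mul_left, h1]
  simp

section
variable {E : Type*} [MeasurableSpace E]

/-- The law of a Poisson(`r`) number together with an independent sequence of independent points
with common law `ν`. The first points of the sequence, as many as that number says, form a Poisson
random measure of intensity `r • ν`. -/
noncomputable def poissonSample (r : ℝ≥0) (ν : Measure E) : Measure (ℕ × (ℕ → E)) :=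
  (poissonMeasure r).prod (Measure.infinitePi fun _ : ℕ => ν)

instance (r : ℝ≥0) (ν : Measure E) [IsProbabilityMeasure ν] :
    IsProbabilityMeasure (poissonSample r ν) := by
  unfold poissonSample; infer_instance

theorem measurable_sum_sample {f : E → ℝ≥0∞} (hf : Measurable f) :
    Measurable fun ω : ℕ × (ℕ → E) => ∑ i ∈ Finset.range ω.1, f (ω.2 i) :=
  measurable_from_prod_countable_right fun n =>
    Finset.measurable_fun_sum (Finset.range n) fun i _ => hf.comp (measurable_pi_apply i)

/-- Campbell's formula for finitely many points. -/
theorem lintegral_sum_poissonSample (r : ℝ≥0) (ν : Measure E) [IsProbabilityMeasure ν]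
    {f : E → ℝ≥0∞} (hf : Measurable f) :
    ∫⁻ ω, ∑ i ∈ Finset.range ω.1, f (ω.2 i) ∂(poissonSample r ν) = r * ∫⁻ x, f x ∂ν := by
  rw [poissonSample, lintegral_prod _ (measurable_sum_sample hf).aemeasurable]
  have h : ∀ i : ℕ, ∫⁻ x : ℕ → E, f (x i) ∂(Measure.infinitePi fun _ : ℕ => ν) = ∫⁻ x, f x ∂ν :=
    fun i => by
      rw [← (measurePreserving_eval_infinitePi (fun _ : ℕ => ν) i).lintegral_comp hf]
  have h2 : ∀ n : ℕ, ∫⁻ x : ℕ → E, ∑ i ∈ Finset.range n, f (x i)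
      ∂(Measure.infinitePi fun _ : ℕ => ν) = n * ∫⁻ x, f x ∂ν := fun n => by
    rw [lintegral_finsetSum _ fun i _ => by fun_prop]
    simp [h]
  simp only [h2]
  rw [lintegral_mul_const _ measurable_from_top, lintegral_natCast_poissonMeasure]

theorem integral_prod_infinitePi (ν : Measure E) [IsProbabilityMeasure ν]
    {φ : E → ℂ} (hφ : Measurable φ) (n : ℕ) :
    ∫ x : ℕ → E, ∏ i ∈ Finset.range n, φ (x i) ∂(Measure.infinitePi fun _ : ℕ => ν) =
      (∫ x, φ x ∂ν) ^ n := by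
  have hi := (iIndepFun_infinitePi (P := fun _ : ℕ => ν) (X := fun _ => φ) fun _ => hφ).precomp
    (g := fun i : Fin n => (i : ℕ)) Fin.val_injective
  have h := hi.integral_fun_prod_eq_prod_integral fun i => by
    exact (hφ.comp (measurable_pi_apply _)).aestronglyMeasurable
  simp only [Finset.prod_range]
  rw [h]
  have h1 : ∀ i : Fin n, ∫ x : ℕ → E, φ (x i) ∂(Measure.infinitePi fun _ : ℕ => ν) =
      ∫ x, φ x ∂ν := fun i => by
    have h := measurePreserving_eval_infinitePi (fun _ : ℕ => ν) (i : ℕ)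
    have h' := integral_map (μ := Measure.infinitePi fun _ : ℕ => ν) (f := φ)
      h.measurable.aemeasurable hφ.aestronglyMeasurable
    rw [h.map_eq] at h'
    exact h'.symm
  simp [h1]

theorem measurable_prod_sample {φ : E → ℂ} (hφ : Measurable φ) :
    Measurable fun ω : ℕ × (ℕ → E) => ∏ i ∈ Finset.range ω.1, φ (ω.2 i) :=
  measurable_from_prod_countable_right fun n =>
    Finset.measurable_fun_prod (Finset.range n) fun i _ => hφ.comp (measurable_pi_apply i)

/-- The probability generating functional of finitely many Poisson points. -/
theorem integral_prod_poissonSample (r : ℝ≥0) (ν : Measure E) [IsProbabilityMeasure ν]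
    {φ : E → ℂ} (hφ : Measurable φ) (hφ1 : ∀ x, ‖φ x‖ ≤ 1) :
    ∫ ω, ∏ i ∈ Finset.range ω.1, φ (ω.2 i) ∂(poissonSample r ν) =
      Complex.exp (r * ((∫ x, φ x ∂ν) - 1)) := by
  have hint : Integrable (fun ω : ℕ × (ℕ → E) => ∏ i ∈ Finset.range ω.1, φ (ω.2 i))
      (poissonSample r ν) := by
    refine Integrable.of_bound (measurable_prod_sample hφ).aestronglyMeasurable 1
      (ae_of_all _ fun ω => ?_)
    rw [norm_prod]
    exact Finset.prod_le_one (fun _ _ => norm_nonneg _) fun _ _ => hφ1 _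
  rw [poissonSample] at hint ⊢
  rw [integral_prod _ hint]
  simp only [integral_prod_infinitePi ν hφ]
  rw [integral_poissonMeasure]
  set w := ∫ x, φ x ∂ν
  calc ∑' n : ℕ, (Real.exp (-r) * r ^ n / n.factorial) • w ^ n
      = ∑' n : ℕ, (Real.exp (-r) : ℂ) * ((r * w) ^ n / n.factorial) := by
        congr with n
        rw [Complex.real_smul]
        push_cast
        rw [mul_pow]
        ring
    _ = Complex.exp (r * (w - 1)) := by
        rw [tsum_mul_left, (NormedSpace.expSeries_div_hasSum_exp (r * w : ℂ)).tsum_eq,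
          ← Complex.exp_eq_exp_ℂ, Complex.ofReal_exp, ← Complex.exp_add]
        congr 1
        push_cast
        ring
end

/-! ### Superposition and the exponential functional -/

section
variable {E : Type*} [MeasurableSpace E]

/-- The point measure coded by a sequence of pairs (number of points, sequence of points):
the superposition over `n` of the point masses at the first `(s n).1` entries of `(s n).2`. -/
noncomputable def pointMeasure (s : ℕ → ℕ × (ℕ → E)) : Measure E :=
  Measure.sum fun n => ∑ i ∈ Finset.range (s n).1, Measure.dirac ((s n).2 i)

/-- The law of a sequence of independent Poisson samples with intensities `r n • ν n`; under it
`pointMeasure` is a Poisson random measure with intensity `∑ r n • ν n`. -/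
noncomputable def poissonLaw (r : ℕ → ℝ≥0) (ν : ℕ → Measure E) :
    Measure (ℕ → ℕ × (ℕ → E)) :=
  Measure.infinitePi fun n => poissonSample (r n) (ν n)

instance (r : ℕ → ℝ≥0) (ν : ℕ → Measure E) [∀ n, IsProbabilityMeasure (ν n)] :
    IsProbabilityMeasure (poissonLaw r ν) := by
  unfold poissonLaw; infer_instance

theorem lintegral_pointMeasure (s : ℕ → ℕ × (ℕ → E)) {f : E → ℝ≥0∞} (hf : Measurable f) :
    ∫⁻ x, f x ∂(pointMeasure s) = ∑' n, ∑ i ∈ Finset.range (s n).1, f ((s n).2 i) := by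
  simp only [pointMeasure, lintegral_sum_measure, lintegral_finsetSum_measure,
    lintegral_dirac' _ hf]

theorem measurable_lintegral_pointMeasure {α : Type*} [MeasurableSpace α] {f : α × E → ℝ≥0∞}
    (hf : Measurable f) :
    Measurable fun p : α × (ℕ → ℕ × (ℕ → E)) => ∫⁻ x, f (p.1, x) ∂(pointMeasure p.2) := by
  have h1 : ∀ p : α × (ℕ → ℕ × (ℕ → E)), ∫⁻ x, f (p.1, x) ∂(pointMeasure p.2) =
      ∑' n, ∑ i ∈ Finset.range (p.2 n).1, f (p.1, (p.2 n).2 i) := fun p =>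
    lintegral_pointMeasure _ (hf.comp measurable_prodMk_left)
  simp only [h1]
  refine Measurable.tsum fun n => ?_
  have h2 : Measurable fun q : ℕ × (α × (ℕ → E)) =>
      ∑ i ∈ Finset.range q.1, f (q.2.1, q.2.2 i) :=
    measurable_from_prod_countable_right fun m =>
      Finset.measurable_fun_sum (Finset.range m) fun i _ => hf.comp (by fun_prop)
  have h3 : Measurable fun p : α × (ℕ → ℕ × (ℕ → E)) => ((p.2 n).1, (p.1, (p.2 n).2)) := by
    fun_prop
  exact h2.comp h3

theorem measurable_pointMeasure : Measurable (pointMeasure (E := E)) := by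
  refine Measure.measurable_of_measurable_coe _ fun B hB => ?_
  have h := (measurable_lintegral_pointMeasure (α := Unit)
    (f := fun p => B.indicator 1 p.2)
    ((measurable_one.indicator hB).comp measurable_snd)).comp
    (measurable_prodMk_left (x := ()))
  convert h using 1
  ext s
  simp [lintegral_indicator_one hB]

variable (r : ℕ → ℝ≥0) (ν : ℕ → Measure E) [∀ n, IsProbabilityMeasure (ν n)]

/-- Campbell's formula. -/
theorem lintegral_lintegral_pointMeasure {f : E → ℝ≥0∞} (hf : Measurable f) :
    ∫⁻ s, ∫⁻ x, f x ∂(pointMeasure s) ∂(poissonLaw r ν) =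
      ∫⁻ x, f x ∂(Measure.sum fun n => r n • ν n) := by
  simp only [lintegral_pointMeasure _ hf, lintegral_sum_measure]
  have h1 := lintegral_tsum (μ := poissonLaw r ν)
    (f := fun n (s : ℕ → ℕ × (ℕ → E)) => ∑ i ∈ Finset.range (s n).1, f ((s n).2 i))
    fun n => ((measurable_sum_sample hf).comp (measurable_pi_apply n)).aemeasurable
  rw [h1]
  congr with n
  rw [lintegral_smul_measure]
  have h := (measurePreserving_eval_infinitePi
    (fun n => poissonSample (r n) (ν n)) n).lintegral_comp (measurable_sum_sample hf)
  exact h.trans (lintegral_sum_poissonSample (r n) (ν n) hf)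

theorem ae_integrable_pointMeasure {f : E → ℝ} (hfm : Measurable f)
    (hf : Integrable f (Measure.sum fun n => r n • ν n)) :
    ∀ᵐ s ∂(poissonLaw r ν), Integrable f (pointMeasure s) := by
  have hm : Measurable fun x => ‖f x‖ₑ := by fun_prop
  have h := lintegral_lintegral_pointMeasure r ν hm
  have hfin : ∫⁻ s, ∫⁻ x, ‖f x‖ₑ ∂(pointMeasure s) ∂(poissonLaw r ν) ≠ ∞ := by
    rw [h]; exact hf.2.ne
  have hmeas : Measurable fun s : ℕ → ℕ × (ℕ → E) => ∫⁻ x, ‖f x‖ₑ ∂(pointMeasure s) :=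
    (Measure.measurable_lintegral hm).comp measurable_pointMeasure
  filter_upwards [ae_lt_top hmeas hfin] with s hs
  exact ⟨hfm.aestronglyMeasurable, hs⟩

theorem norm_exp_sub_one_le_of_re_nonpos {w : ℂ} (hw : w.re ≤ 0) :
    ‖Complex.exp w - 1‖ ≤ 2 * ‖w‖ := by
  rcases le_total ‖w‖ 1 with h | h
  · exact Complex.norm_exp_sub_one_le h
  · calc ‖Complex.exp w - 1‖ ≤ ‖Complex.exp w‖ + ‖(1 : ℂ)‖ := norm_sub_le _ _
      _ ≤ 1 + 1 := by
        rw [Complex.norm_exp, norm_one]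
        gcongr
        exact Real.exp_le_one_iff.2 hw
      _ ≤ 2 * ‖w‖ := by linarith

theorem hasSum_integral_pointMeasure (s : ℕ → ℕ × (ℕ → E)) {f : E → ℝ} (hfm : Measurable f)
    (hf : Integrable f (pointMeasure s)) :
    HasSum (fun n => ∑ i ∈ Finset.range (s n).1, f ((s n).2 i)) (∫ x, f x ∂(pointMeasure s)) := by
  have h := hasSum_integral_measure hf
  have h2 : ∀ n, ∫ x, f x ∂(∑ i ∈ Finset.range (s n).1, Measure.dirac ((s n).2 i)) =
      ∑ i ∈ Finset.range (s n).1, f ((s n).2 i) := fun n => by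
    rw [integral_finsetSum_measure fun i _ => integrable_dirac' hfm.stronglyMeasurable (by simp)]
    exact Finset.sum_congr rfl fun i _ => integral_dirac' _ _ hfm.stronglyMeasurable
  simp only [h2] at h
  exact h

theorem integrable_exp_sub_one {m : Measure E} {f : E → ℝ} (hfm : Measurable f)
    (hf : Integrable f m) {c : ℂ} (hc : ∀ x, (c * f x).re ≤ 0) :
    Integrable (fun x => Complex.exp (c * f x) - 1) m := by
  refine ((hf.norm.const_mul (2 * ‖c‖))).mono' (by fun_prop) (ae_of_all _ fun x => ?_)
  refine (norm_exp_sub_one_le_of_re_nonpos (hc x)).trans (le_of_eq ?_)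
  rw [norm_mul, Complex.norm_real]; ring

/-- The exponential functional of a Poisson random measure. It contains both the Laplace
functional (`c` negative, `f ≥ 0`) and the characteristic functional (`c` imaginary). -/
theorem integral_exp_pointMeasure {f : E → ℝ} (hfm : Measurable f)
    (hf : Integrable f (Measure.sum fun n => r n • ν n)) {c : ℂ} (hc : ∀ x, (c * f x).re ≤ 0) :
    ∫ s, Complex.exp (c * (∫ x, f x ∂(pointMeasure s) : ℝ)) ∂(poissonLaw r ν) =
      Complex.exp (∫ x, (Complex.exp (c * f x) - 1) ∂(Measure.sum fun n => r n • ν n)) := by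
  set φ : E → ℂ := fun x => Complex.exp (c * f x) with hφdef
  have hφ : Measurable φ := by fun_prop
  have hφ1 : ∀ x, ‖φ x‖ ≤ 1 := fun x => by
    rw [Complex.norm_exp]; exact Real.exp_le_one_iff.2 (hc x)
  -- the contribution of the `n`-th sample
  let Y : ℕ → (ℕ → ℕ × (ℕ → E)) → ℂ := fun n s => ∏ i ∈ Finset.range (s n).1, φ ((s n).2 i)
  have hY : ∀ n, Measurable (Y n) := fun n =>
    (measurable_prod_sample hφ).comp (measurable_pi_apply n)
  have hY1 : ∀ n s, ‖Y n s‖ ≤ 1 := fun n s => by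
    simp only [Y, norm_prod]
    exact Finset.prod_le_one (fun _ _ => norm_nonneg _) fun _ _ => hφ1 _
  have hYint : ∀ n, ∫ s, Y n s ∂(poissonLaw r ν) =
      Complex.exp (∫ x, (φ x - 1) ∂(r n • ν n)) := fun n => by
    have h := measurePreserving_eval_infinitePi (fun n => poissonSample (r n) (ν n)) n
    have h' := integral_map (μ := poissonLaw r ν) h.measurable.aemeasurable
      (measurable_prod_sample hφ).aestronglyMeasurable
    have h1 : Integrable φ (ν n) := Integrable.of_bound hφ.aestronglyMeasurable 1 (ae_of_all _ hφ1)
    rw [poissonLaw, h.map_eq, integral_prod_poissonSample _ _ hφ hφ1] at h'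
    refine h'.symm.trans ?_
    rw [integral_smul_nnreal_measure, integral_sub h1 (integrable_const _)]
    simp [NNReal.smul_def]
  have hprod : ∀ M, ∫ s, ∏ n ∈ Finset.range M, Y n s ∂(poissonLaw r ν) =
      Complex.exp (∑ n ∈ Finset.range M, ∫ x, (φ x - 1) ∂(r n • ν n)) := fun M => by
    have hi := (iIndepFun_infinitePi (P := fun n => poissonSample (r n) (ν n))
      (X := fun _ ω => ∏ i ∈ Finset.range ω.1, φ (ω.2 i))
      fun _ => measurable_prod_sample hφ).precomp
      (g := fun i : Fin M => (i : ℕ)) Fin.val_injective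
    have h := hi.integral_fun_prod_eq_prod_integral fun i => (hY i).aestronglyMeasurable
    simp only [Finset.prod_range, Complex.exp_sum]
    refine h.trans (Finset.prod_congr rfl fun i _ => hYint i)
  have hsum : HasSum (fun n => ∫ x, (φ x - 1) ∂(r n • ν n))
      (∫ x, (φ x - 1) ∂(Measure.sum fun n => r n • ν n)) :=
    hasSum_integral_measure (integrable_exp_sub_one hfm hf hc)
  have hlim1 := ((Complex.continuous_exp.tendsto _).comp hsum.tendsto_sum_nat)
  have hlim2 : Tendsto (fun M => ∫ s, ∏ n ∈ Finset.range M, Y n s ∂(poissonLaw r ν)) atTop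
      (𝓝 (∫ s, Complex.exp (c * (∫ x, f x ∂(pointMeasure s) : ℝ)) ∂(poissonLaw r ν))) := by
    refine tendsto_integral_of_dominated_convergence (fun _ => 1)
      (fun M => (Finset.measurable_fun_prod _ fun n _ => hY n).aestronglyMeasurable)
      (integrable_const _) (fun M => ae_of_all _ fun s => ?_) ?_
    · rw [norm_prod]
      exact Finset.prod_le_one (fun _ _ => norm_nonneg _) fun _ _ => hY1 _ _
    · filter_upwards [ae_integrable_pointMeasure r ν hfm hf] with s hs
      have h1 := (hasSum_integral_pointMeasure s hfm hs).tendsto_sum_nat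
      have h2 : Tendsto (fun M => Complex.exp (c * (∑ n ∈ Finset.range M,
          ∑ i ∈ Finset.range (s n).1, f ((s n).2 i) : ℝ))) atTop
          (𝓝 (Complex.exp (c * (∫ x, f x ∂(pointMeasure s) : ℝ)))) :=
        (Complex.continuous_exp.tendsto _).comp
          (((Complex.continuous_ofReal.tendsto _).comp h1).const_mul c)
      refine h2.congr fun M => ?_
      simp only [Y, φ, ← Complex.exp_sum, Complex.ofReal_sum, Finset.mul_sum]
  refine tendsto_nhds_unique hlim2 ?_
  simp only [hprod]
  exact hlim1
end

/-! ### Counts in disjoint sets -/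

theorem exp_sum_indicator_sub_one {E ι : Type*} [Fintype ι] {B : ι → Set E}
    (hd : Pairwise fun i j => Disjoint (B i) (B j)) (t : ι → ℝ) (x : E) :
    Complex.exp (Complex.I * (∑ i, (B i).indicator (fun _ => t i) x : ℝ)) - 1 =
      ∑ i, (B i).indicator (fun _ => Complex.exp (Complex.I * t i) - 1) x := by
  by_cases hx : ∃ i, x ∈ B i
  · obtain ⟨i, hi⟩ := hx
    have hj : ∀ j, j ≠ i → x ∉ B j := fun j hji hxj =>
      Set.disjoint_left.1 (hd hji) hxj hi
    rw [Finset.sum_eq_single i (fun j _ hji => indicator_of_notMem (hj j hji) _) (by simp),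
      Finset.sum_eq_single i (fun j _ hji => indicator_of_notMem (hj j hji) _) (by simp),
      indicator_of_mem hi, indicator_of_mem hi]
  · push Not at hx
    simp [indicator_of_notMem (hx _)]

section
variable {E : Type*} [MeasurableSpace E]
variable (r : ℕ → ℝ≥0) (ν : ℕ → Measure E) [∀ n, IsProbabilityMeasure (ν n)]

theorem ae_pointMeasure_lt_top {B : Set E} (hB : MeasurableSet B)
    (hBf : (Measure.sum fun n => r n • ν n) B < ∞) :
    ∀ᵐ s ∂(poissonLaw r ν), pointMeasure s B < ∞ := by
  have h := lintegral_lintegral_pointMeasure r ν (f := B.indicator 1) (measurable_one.indicator hB)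
  simp only [lintegral_indicator_one hB] at h
  exact ae_lt_top ((Measure.measurable_coe hB).comp measurable_pointMeasure) (h ▸ hBf.ne)

/-- The joint characteristic function of the numbers of points in disjoint sets. -/
theorem integral_exp_pointMeasure_disjoint {ι : Type*} [Fintype ι] {B : ι → Set E}
    (hB : ∀ i, MeasurableSet (B i)) (hBf : ∀ i, (Measure.sum fun n => r n • ν n) (B i) < ∞)
    (hd : Pairwise fun i j => Disjoint (B i) (B j)) (t : ι → ℝ) :
    ∫ s, Complex.exp (Complex.I * (∑ i, t i * (pointMeasure s).real (B i) : ℝ))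
      ∂(poissonLaw r ν) =
    ∏ i, Complex.exp ((Measure.sum fun n => r n • ν n).real (B i) *
      (Complex.exp (Complex.I * t i) - 1)) := by
  set μ := Measure.sum fun n => r n • ν n with hμ
  let f : E → ℝ := fun x => ∑ i, (B i).indicator (fun _ => t i) x
  have hfm : Measurable f :=
    Finset.measurable_fun_sum _ fun i _ => measurable_const.indicator (hB i)
  have hind : ∀ i, Integrable ((B i).indicator fun _ => t i) μ := fun i =>
    (integrable_indicator_iff (hB i)).2 (integrableOn_const (hBf i).ne)
  have hf : Integrable f μ := integrable_finsetSum _ fun i _ => hind i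
  have h := integral_exp_pointMeasure r ν hfm hf (c := Complex.I) (by simp)
  have h1 : ∀ᵐ s ∂(poissonLaw r ν),
      ∫ x, f x ∂(pointMeasure s) = ∑ i, t i * (pointMeasure s).real (B i) := by
    filter_upwards [ae_all_iff.2 fun i => ae_pointMeasure_lt_top r ν (hB i) (hBf i)] with s hs
    have hi : ∀ i, Integrable ((B i).indicator fun _ => t i) (pointMeasure s) := fun i =>
      (integrable_indicator_iff (hB i)).2 (integrableOn_const (hs i).ne)
    simp only [f]
    rw [integral_finsetSum _ fun i _ => hi i]
    refine Finset.sum_congr rfl fun i _ => ?_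
    rw [integral_indicator_const _ (hB i), smul_eq_mul, mul_comm]
  have h2 : ∫ x, (Complex.exp (Complex.I * f x) - 1) ∂μ =
      ∑ i, μ.real (B i) * (Complex.exp (Complex.I * t i) - 1) := by
    simp only [f, exp_sum_indicator_sub_one hd]
    rw [integral_finsetSum]
    · refine Finset.sum_congr rfl fun i _ => ?_
      rw [integral_indicator_const _ (hB i), Complex.real_smul]
    · exact fun i _ => (integrable_indicator_iff (hB i)).2 (integrableOn_const (hBf i).ne)
  rw [h2, Complex.exp_sum] at h
  rw [← h]
  refine integral_congr_ae ?_
  filter_upwards [h1] with s hs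
  rw [hs]

variable {Ω : Type*} [MeasurableSpace Ω] {P : Measure Ω} {X : Ω → ℕ → ℕ × (ℕ → E)}

/-- Whenever the random element `X` has the law `poissonLaw r ν`, the point measure it codes is a
Poisson random measure. The counts are read as real numbers, to which characteristic functions
apply: their joint one factorises, into those of Poisson laws. -/
theorem isPoissonRandomMeasure_pointMeasure (hX : MeasurePreserving X P (poissonLaw r ν)) :
    IsPoissonRandomMeasure P (fun ω => pointMeasure (X ω)) (Measure.sum fun n => r n • ν n) := by
  set μ := Measure.sum fun n => r n • ν n with hμ
  have hprob : IsProbabilityMeasure P := ⟨by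
    rw [← preimage_univ (f := X), hX.measure_preimage MeasurableSet.univ.nullMeasurableSet,
      measure_univ]⟩
  have hmeas : ∀ B, MeasurableSet B → Measurable fun ω => pointMeasure (X ω) B := fun B hB =>
    ((Measure.measurable_coe hB).comp measurable_pointMeasure).comp hX.measurable
  have hmeasr : ∀ B, MeasurableSet B → Measurable fun ω => (pointMeasure (X ω)).real B :=
    fun B hB => (hmeas B hB).ennreal_toReal
  have hofReal : ∀ B, MeasurableSet B → μ B < ∞ →
      (fun ω => ENNReal.ofReal ((pointMeasure (X ω)).real B)) =ᵐ[P]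
        fun ω => pointMeasure (X ω) B := fun B hB hBf => by
    filter_upwards [hX.quasiMeasurePreserving.ae (ae_pointMeasure_lt_top r ν hB hBf)] with ω hω
    rw [Measure.real, ENNReal.ofReal_toReal hω.ne]
  have hjoint : ∀ (n : ℕ) (B : Fin n → Set E), (∀ i, MeasurableSet (B i)) →
      (∀ i, μ (B i) < ∞) → (Pairwise fun i j => Disjoint (B i) (B j)) → ∀ t : Fin n → ℝ,
      ∫ ω, Complex.exp (Complex.I * (∑ i, t i * (pointMeasure (X ω)).real (B i) : ℝ)) ∂P =
        ∏ i, Complex.exp (μ.real (B i) * (Complex.exp (Complex.I * t i) - 1)) :=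
    fun n B hB hBf hd t => by
    rw [← integral_exp_pointMeasure_disjoint r ν hB hBf hd t, ← hX.map_eq,
      integral_map hX.measurable.aemeasurable]
    have : Measurable fun s : ℕ → ℕ × (ℕ → E) => ∑ i, t i * (pointMeasure s).real (B i) :=
      Finset.measurable_fun_sum _ fun i _ =>
        (((Measure.measurable_coe (hB i)).comp measurable_pointMeasure).ennreal_toReal).const_mul _
    exact (by fun_prop : Measurable _).aestronglyMeasurable
  have hchar : ∀ B, MeasurableSet B → μ B < ∞ → ∀ t : ℝ,
      charFun (P.map fun ω => (pointMeasure (X ω)).real B) t =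
        Complex.exp (μ.real B * (Complex.exp (Complex.I * t) - 1)) := fun B hB hBf t => by
    have h := hjoint 1 (fun _ => B) (fun _ => hB) (fun _ => hBf)
      (fun i j hij => absurd (Subsingleton.elim i j) hij) fun _ => t
    rw [charFun_apply_real, integral_map (hmeasr B hB).aemeasurable (by fun_prop)]
    simp only [Fin.sum_univ_one, Fin.prod_univ_one] at h
    rw [← h]
    congr with ω
    push_cast
    ring_nf
  refine ⟨measurable_pointMeasure.comp hX.measurable, fun B hB hBf => ?_,
    fun n B hB hBf hd => ?_⟩
  · refine ⟨(hmeas B hB).aemeasurable, ?_⟩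
    have hlaw : P.map (fun ω => (pointMeasure (X ω)).real B) =
        (poissonMeasure (μ B).toNNReal).map (Nat.cast : ℕ → ℝ) := by
      have := Measure.isProbabilityMeasure_map (μ := P) (hmeasr B hB).aemeasurable
      refine Measure.ext_of_charFun (funext fun t => ?_)
      rw [hchar B hB hBf, charFun_map_cast_poissonMeasure, mul_comm Complex.I]
      rfl
    have hcomp := Measure.map_map (μ := P) ENNReal.measurable_ofReal (hmeasr B hB)
    rw [← Measure.map_congr (hofReal B hB hBf)]
    refine hcomp.symm.trans ?_
    rw [hlaw, Measure.map_map ENNReal.measurable_ofReal measurable_from_top]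
    congr 1
    ext k
    simp
  · have hr : iIndepFun (fun i ω => (pointMeasure (X ω)).real (B i)) P := by
      rw [iIndepFun_iff_charFun_pi fun i => (hmeasr _ (hB i)).aemeasurable]
      intro t
      simp only [hchar _ (hB _) (hBf _)]
      have hm : Measurable fun ω =>
          WithLp.toLp 2 fun i => (pointMeasure (X ω)).real (B i) :=
        (WithLp.measurable_toLp 2 _).comp (measurable_pi_lambda _ fun i => hmeasr _ (hB i))
      rw [← hjoint n B hB hBf hd, charFun_apply, integral_map hm.aemeasurable (by fun_prop)]
      congr with ω
      rw [PiLp.inner_apply, mul_comm]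
      simp
    exact (hr.comp (fun _ => ENNReal.ofReal) fun _ => ENNReal.measurable_ofReal).congr
      fun i => hofReal _ (hB i) (hBf i)
end

/-! ### Compensated integrals of nonnegative functions -/

/-- The function `y ↦ e^{-y} - 1 + y`, which governs the Laplace transforms of compensated Poisson
integrals. It is nonnegative and vanishes only at `0`, so that it also measures deviations
from `0`. -/
noncomputable def expRemainder (y : ℝ) : ℝ := Real.exp (-y) - 1 + y

theorem continuous_expRemainder : Continuous expRemainder := by
  unfold expRemainder; fun_prop

@[fun_prop]
theorem measurable_expRemainder : Measurable expRemainder := continuous_expRemainder.measurable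

theorem expRemainder_zero : expRemainder 0 = 0 := by simp [expRemainder]

theorem expRemainder_nonneg (y : ℝ) : 0 ≤ expRemainder y := by
  have := Real.add_one_le_exp (-y)
  unfold expRemainder; linarith

theorem expRemainder_pos {y : ℝ} (hy : y ≠ 0) : 0 < expRemainder y := by
  have := Real.add_one_lt_exp (neg_ne_zero.2 hy)
  unfold expRemainder; linarith

theorem expRemainder_le_self {y : ℝ} (hy : 0 ≤ y) : expRemainder y ≤ y := by
  have : Real.exp (-y) ≤ 1 := Real.exp_le_one_iff.2 (by linarith)
  unfold expRemainder; linarith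

theorem expRemainder_le_sq {y : ℝ} (hy : 0 ≤ y) : expRemainder y ≤ y ^ 2 := by
  rcases le_total y 1 with h | h
  · have := Real.abs_exp_sub_one_sub_id_le (x := -y) (by rw [abs_neg, abs_of_nonneg hy]; exact h)
    have h2 := (abs_le.1 this).2
    unfold expRemainder; nlinarith
  · exact (expRemainder_le_self hy).trans (by nlinarith)

theorem expRemainder_le_of_le_abs {r y : ℝ} (hr : 0 ≤ r) (h : r ≤ |y|) :
    expRemainder r ≤ expRemainder y := by
  have hmono : ∀ t, r ≤ t → expRemainder r ≤ expRemainder t := fun t ht => by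
    have h1 := Real.add_one_le_exp (-(t - r))
    have h2 : Real.exp (-t) = Real.exp (-r) * Real.exp (-(t - r)) := by
      rw [← Real.exp_add]; ring_nf
    have h3 : Real.exp (-r) ≤ 1 := Real.exp_le_one_iff.2 (by linarith)
    have h4 := Real.exp_pos (-r)
    unfold expRemainder
    nlinarith [mul_le_mul_of_nonneg_left h1 h4.le]
  refine (hmono _ h).trans ?_
  rcases le_total 0 y with hy | hy
  · rw [abs_of_nonneg hy]
  · rw [abs_of_nonpos hy]
    have := Real.self_le_sinh_iff.2 (neg_nonneg.2 hy)
    rw [Real.sinh_eq] at this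
    unfold expRemainder
    linarith

theorem measure_le_abs_le_lintegral_expRemainder {Ω : Type*} [MeasurableSpace Ω] (Q : Measure Ω)
    {Y : Ω → ℝ} (hY : AEMeasurable Y Q) {r : ℝ} (hr : 0 < r) :
    Q {ω | r ≤ |Y ω|} ≤
      (∫⁻ ω, ENNReal.ofReal (expRemainder (Y ω)) ∂Q) / ENNReal.ofReal (expRemainder r) := by
  have hpos : ENNReal.ofReal (expRemainder r) ≠ 0 := by
    simpa using expRemainder_pos hr.ne'
  refine (measure_mono fun ω hω => ?_).trans (meas_ge_le_lintegral_div
    (measurable_expRemainder.comp_aemeasurable hY).ennreal_ofReal hpos ENNReal.ofReal_ne_top)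
  exact ENNReal.ofReal_le_ofReal (expRemainder_le_of_le_abs hr.le hω)

/-- Convergence of expectations along an almost surely convergent sequence that is bounded
in `L²`. -/
theorem lintegral_eq_of_tendsto_of_lintegral_sq_le {Ω : Type*} [MeasurableSpace Ω] (Q : Measure Ω)
    [IsProbabilityMeasure Q] {y : ℕ → Ω → ℝ≥0∞} {g : Ω → ℝ≥0∞} (hy : ∀ k, Measurable (y k))
    (hlim : ∀ᵐ ω ∂Q, Tendsto (fun k => y k ω) atTop (𝓝 (g ω))) {C L : ℝ≥0∞} (hC : C ≠ ∞)
    (hsq : ∀ k, ∫⁻ ω, y k ω ^ 2 ∂Q ≤ C)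
    (hL : Tendsto (fun k => ∫⁻ ω, y k ω ∂Q) atTop (𝓝 L)) : ∫⁻ ω, g ω ∂Q = L := by
  apply le_antisymm
  · calc ∫⁻ ω, g ω ∂Q = ∫⁻ ω, liminf (fun k => y k ω) atTop ∂Q :=
          lintegral_congr_ae (hlim.mono fun ω h => h.liminf_eq.symm)
      _ ≤ liminf (fun k => ∫⁻ ω, y k ω ∂Q) atTop := lintegral_liminf_le hy
      _ = L := hL.liminf_eq
  -- truncation at height `M + 1` costs at most `C / (M + 1)`, since `y ≤ min y c + y² / c`
  have hmain : ∀ M : ℕ, L ≤ ∫⁻ ω, g ω ∂Q + C / (M + 1 : ℕ) := fun M => by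
    have hM0 : ((M + 1 : ℕ) : ℝ≥0∞) ≠ 0 := by simp
    have hMt : ((M + 1 : ℕ) : ℝ≥0∞) ≠ ∞ := ENNReal.natCast_ne_top _
    have hb : ∀ k ω, y k ω ≤ min (y k ω) (M + 1 : ℕ) + y k ω ^ 2 / (M + 1 : ℕ) := fun k ω => by
      rcases le_total (y k ω) (M + 1 : ℕ) with h | h
      · rw [min_eq_left h]; exact le_self_add
      · refine le_add_left ?_
        rw [ENNReal.le_div_iff_mul_le (.inl hM0) (.inl hMt), sq]
        gcongr
    have h1 : ∀ k, ∫⁻ ω, y k ω ∂Q ≤ ∫⁻ ω, min (y k ω) (M + 1 : ℕ) ∂Q + C / (M + 1 : ℕ) :=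
      fun k => by
      refine (lintegral_mono (hb k)).trans ?_
      rw [lintegral_add_left ((hy k).min measurable_const)]
      gcongr
      simp only [div_eq_mul_inv]
      rw [lintegral_mul_const _ ((hy k).pow_const 2)]
      gcongr
      exact hsq k
    have h2 : Tendsto (fun k => ∫⁻ ω, min (y k ω) (M + 1 : ℕ) ∂Q) atTop
        (𝓝 (∫⁻ ω, min (g ω) (M + 1 : ℕ) ∂Q)) := by
      refine tendsto_lintegral_of_dominated_convergence (fun _ => ((M + 1 : ℕ) : ℝ≥0∞))
        (fun k => (hy k).min measurable_const) (fun k => ae_of_all _ fun ω => min_le_right _ _)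
        (by simp) ?_
      filter_upwards [hlim] with ω hω
      exact hω.min tendsto_const_nhds
    have h3 : L ≤ ∫⁻ ω, min (g ω) (M + 1 : ℕ) ∂Q + C / (M + 1 : ℕ) :=
      le_of_tendsto_of_tendsto' hL (h2.add_const _) h1
    refine h3.trans ?_
    gcongr
    exact min_le_left _ _
  have hlim0 : Tendsto (fun M : ℕ => ∫⁻ ω, g ω ∂Q + C / (M + 1 : ℕ)) atTop
      (𝓝 (∫⁻ ω, g ω ∂Q + 0)) := by
    refine Tendsto.const_add _ ?_
    have h := (ENNReal.tendsto_inv_nat_nhds_zero.comp (tendsto_add_atTop_nat 1))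
    simpa [div_eq_mul_inv] using ENNReal.Tendsto.const_mul h (.inr hC)
  rw [add_zero] at hlim0
  exact ge_of_tendsto' hlim0 hmain

theorem exists_eq_sum_smul_probabilityMeasure {E : Type*} [MeasurableSpace E] [Nonempty E]
    (μ : Measure E) [SFinite μ] :
    ∃ (r : ℕ → ℝ≥0) (ν : ℕ → Measure E), (∀ n, IsProbabilityMeasure (ν n)) ∧
      (Measure.sum fun n => r n • ν n) = μ := by
  let m : ℕ → FiniteMeasure E := fun n => ⟨sfiniteSeq μ n, inferInstance⟩
  refine ⟨fun n => (m n).mass, fun n => ((m n).normalize : Measure E), fun n => inferInstance, ?_⟩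
  rw [← sum_sfiniteSeq μ]
  congr with n : 1
  exact (congrArg (fun m : FiniteMeasure E => (m : Measure E))
    (m n).self_eq_mass_smul_normalize).symm

section
variable {E : Type*} [MeasurableSpace E]
variable (r : ℕ → ℝ≥0) (ν : ℕ → Measure E) [∀ n, IsProbabilityMeasure (ν n)] {μ : Measure E}

/-- The integral of `f` with respect to the compensated measure `pointMeasure s - μ`. -/
noncomputable def compensated (μ : Measure E) (f : E → ℝ) (s : ℕ → ℕ × (ℕ → E)) : ℝ :=
  (∫ x, f x ∂(pointMeasure s)) - ∫ x, f x ∂μ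

theorem integral_pointMeasure_of_nonneg {f : E → ℝ} (hfm : Measurable f) (hf0 : ∀ x, 0 ≤ f x)
    (s : ℕ → ℕ × (ℕ → E)) : ∫ x, f x ∂(pointMeasure s) =
      (∫⁻ x, ENNReal.ofReal (f x) ∂(pointMeasure s)).toReal :=
  integral_eq_lintegral_of_nonneg_ae (ae_of_all _ hf0) hfm.aestronglyMeasurable

theorem measurable_integral_pointMeasure {f : E → ℝ} (hfm : Measurable f) (hf0 : ∀ x, 0 ≤ f x) :
    Measurable fun s => ∫ x, f x ∂(pointMeasure s) := by
  simp only [integral_pointMeasure_of_nonneg hfm hf0]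
  exact ((Measure.measurable_lintegral hfm.ennreal_ofReal).comp
    measurable_pointMeasure).ennreal_toReal

theorem integrable_integral_pointMeasure (hμ : (Measure.sum fun n => r n • ν n) = μ)
    {f : E → ℝ} (hfm : Measurable f) (hf0 : ∀ x, 0 ≤ f x)
    (hf : Integrable f μ) :
    Integrable (fun s => ∫ x, f x ∂(pointMeasure s)) (poissonLaw r ν) ∧
      ∫ s, ∫ x, f x ∂(pointMeasure s) ∂(poissonLaw r ν) = ∫ x, f x ∂μ := by
  have hm : Measurable fun s : ℕ → ℕ × (ℕ → E) => ∫⁻ x, ENNReal.ofReal (f x) ∂(pointMeasure s) :=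
    (Measure.measurable_lintegral hfm.ennreal_ofReal).comp measurable_pointMeasure
  have h := lintegral_lintegral_pointMeasure r ν hfm.ennreal_ofReal
  rw [hμ] at h
  have hfin : ∫⁻ s, ∫⁻ x, ENNReal.ofReal (f x) ∂(pointMeasure s) ∂(poissonLaw r ν) ≠ ∞ := by
    rw [h]; exact hf.lintegral_lt_top.ne
  simp only [integral_pointMeasure_of_nonneg hfm hf0]
  refine ⟨integrable_toReal_of_lintegral_ne_top hm.aemeasurable hfin, ?_⟩
  rw [integral_toReal hm.aemeasurable (ae_lt_top hm hfin), h,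
    integral_eq_lintegral_of_nonneg_ae (ae_of_all _ hf0) hfm.aestronglyMeasurable]

/-- The Laplace transform of a compensated Poisson integral. -/
theorem integral_exp_compensated (hμ : (Measure.sum fun n => r n • ν n) = μ)
    {f : E → ℝ} (hfm : Measurable f) (hf0 : ∀ x, 0 ≤ f x)
    (hf : Integrable f μ) {l : ℝ} (hl : 0 ≤ l) :
    Integrable (fun s => Real.exp (-l * compensated μ f s)) (poissonLaw r ν) ∧
      ∫ s, Real.exp (-l * compensated μ f s) ∂(poissonLaw r ν) =
        Real.exp (∫ x, expRemainder (l * f x) ∂μ) := by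
  subst hμ
  set μ := Measure.sum fun n => r n • ν n with hμ
  have hc := integral_exp_pointMeasure r ν hfm hf (c := ((-l : ℝ) : ℂ)) fun x => by
    rw [← Complex.ofReal_mul, Complex.ofReal_re]
    nlinarith [hf0 x, mul_nonneg hl (hf0 x)]
  have h1 : ∫ x, (Complex.exp (((-l : ℝ) : ℂ) * f x) - 1) ∂μ =
      ((∫ x, (Real.exp (-l * f x) - 1) ∂μ : ℝ) : ℂ) := by
    rw [← integral_complex_ofReal]
    push_cast
    rfl
  have hreal : ∫ s, Real.exp (-l * ∫ x, f x ∂(pointMeasure s)) ∂(poissonLaw r ν) =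
      Real.exp (∫ x, (Real.exp (-l * f x) - 1) ∂μ) := by
    rw [← hμ, h1] at hc
    have h2 : ∫ s, Complex.exp (((-l : ℝ) : ℂ) * (∫ x, f x ∂(pointMeasure s) : ℝ))
        ∂(poissonLaw r ν) =
        ((∫ s, Real.exp (-l * ∫ x, f x ∂(pointMeasure s)) ∂(poissonLaw r ν) : ℝ) : ℂ) := by
      rw [← integral_complex_ofReal]
      push_cast
      rfl
    rw [h2] at hc
    exact_mod_cast hc
  have hsplit : ∀ s, Real.exp (-l * compensated μ f s) =
      Real.exp (-l * ∫ x, f x ∂(pointMeasure s)) * Real.exp (l * ∫ x, f x ∂μ) := fun s => by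
    rw [← Real.exp_add, compensated]; ring_nf
  have hexp : Integrable (fun x => Real.exp (-l * f x) - 1) μ := by
    refine (hf.const_mul l).mono' (by fun_prop) (ae_of_all _ fun x => ?_)
    have h1 := Real.add_one_le_exp (-l * f x)
    have h2 := mul_nonneg hl (hf0 x)
    have h3 : Real.exp (-l * f x) ≤ 1 := Real.exp_le_one_iff.2 (by linarith)
    rw [Real.norm_eq_abs, abs_le]
    constructor <;> linarith
  have hint : Integrable (fun s => Real.exp (-l * ∫ x, f x ∂(pointMeasure s)))
      (poissonLaw r ν) := by
    refine Integrable.of_bound (((measurable_integral_pointMeasure hfm hf0).const_mul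
      (-l)).exp).aestronglyMeasurable 1 (ae_of_all _ fun s => ?_)
    rw [Real.norm_eq_abs, Real.abs_exp]
    have := integral_nonneg (μ := pointMeasure s) (f := f) hf0
    exact Real.exp_le_one_iff.2 (by nlinarith [mul_nonneg hl this])
  simp only [hsplit]
  refine ⟨hint.mul_const _, ?_⟩
  rw [integral_mul_const, hreal, ← Real.exp_add]
  congr 1
  rw [← integral_const_mul, ← integral_add hexp (hf.const_mul l)]
  congr with x
  rw [expRemainder]; ring_nf

/-- This controls the size of a compensated integral: subtracting from the Laplace transform at `1`
the contribution of the mean, which is zero, leaves the expectation of a nonnegative variable. -/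
theorem lintegral_expRemainder_compensated (hμ : (Measure.sum fun n => r n • ν n) = μ)
    {f : E → ℝ} (hfm : Measurable f) (hf0 : ∀ x, 0 ≤ f x)
    (hf : Integrable f μ) :
    ∫⁻ s, ENNReal.ofReal (expRemainder (compensated μ f s)) ∂(poissonLaw r ν) =
      ENNReal.ofReal (Real.exp (∫ x, expRemainder (f x) ∂μ) - 1) := by
  obtain ⟨h1, h2⟩ := integral_exp_compensated r ν hμ hfm hf0 hf zero_le_one
  obtain ⟨h3, h4⟩ := integrable_integral_pointMeasure r ν hμ hfm hf0 hf
  simp only [neg_mul, one_mul] at h1 h2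
  have h5 : Integrable (compensated μ f) (poissonLaw r ν) := h3.sub (integrable_const _)
  have h6 : ∫ s, compensated μ f s ∂(poissonLaw r ν) = 0 := by
    unfold compensated
    rw [integral_sub h3 (integrable_const _), h4]
    simp
  have h7 : Integrable (fun s => expRemainder (compensated μ f s)) (poissonLaw r ν) :=
    (h1.sub (integrable_const 1)).add h5
  have h8 : ∫ s, expRemainder (compensated μ f s) ∂(poissonLaw r ν) =
      Real.exp (∫ x, expRemainder (f x) ∂μ) - 1 := by
    rw [← h2]
    have h9 : Integrable (fun s => Real.exp (-compensated μ f s) - 1) (poissonLaw r ν) :=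
      h1.sub (integrable_const 1)
    unfold expRemainder
    rw [integral_add h9 h5, integral_sub h1 (integrable_const 1), h6]
    simp
  rw [← ofReal_integral_eq_lintegral_ofReal h7 (ae_of_all _ fun s => expRemainder_nonneg _), h8]
end

/-! ### Jumps of bounded height -/

/-- The function `(z, u) ↦ z` on the set `z ∈ D`, `u ≤ x`, extended by zero. -/
noncomputable def cutoffJump (D : Set (Ioi (0 : ℝ))) (x : ℝ) : Ioi (0 : ℝ) × Ioi (0 : ℝ) → ℝ :=
  (D ×ˢ {u : Ioi (0 : ℝ) | (u : ℝ) ≤ x}).indicator fun p => (p.1 : ℝ)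

theorem lebesguePos_le (x : ℝ) :
    lebesguePos {u : Ioi (0 : ℝ) | (u : ℝ) ≤ x} = ENNReal.ofReal x := by
  rw [lebesguePos, comap_subtype_coe_apply measurableSet_Ioi]
  have : ((↑) '' {u : Ioi (0 : ℝ) | (u : ℝ) ≤ x} : Set ℝ) = Ioc 0 x := by
    ext u; simp [and_comm]
  rw [this]; simp

theorem measurableSet_coe_le (x : ℝ) : MeasurableSet {u : Ioi (0 : ℝ) | (u : ℝ) ≤ x} :=
  measurableSet_le measurable_subtype_coe measurable_const

theorem measurableSet_lt_coe (x : ℝ) : MeasurableSet {u : Ioi (0 : ℝ) | x < (u : ℝ)} :=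
  measurableSet_lt measurable_const measurable_subtype_coe

theorem cutoffJump_nonneg (D : Set (Ioi (0 : ℝ))) (x : ℝ) (p : Ioi (0 : ℝ) × Ioi (0 : ℝ)) :
    0 ≤ cutoffJump D x p :=
  indicator_nonneg (fun p _ => le_of_lt p.1.2) p

theorem measurable_cutoffJump {D : Set (Ioi (0 : ℝ))} (hD : MeasurableSet D) (x : ℝ) :
    Measurable (cutoffJump D x) :=
  (by fun_prop : Measurable fun p : Ioi (0 : ℝ) × Ioi (0 : ℝ) => (p.1 : ℝ)).indicator
    (hD.prod (measurableSet_coe_le x))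

theorem measurable_cutoffJump_uncurry {D : Set (Ioi (0 : ℝ))} (hD : MeasurableSet D) :
    Measurable fun q : ℝ × (Ioi (0 : ℝ) × Ioi (0 : ℝ)) => cutoffJump D q.1 q.2 := by
  let T : Set (ℝ × (Ioi (0 : ℝ) × Ioi (0 : ℝ))) := {q | q.2.1 ∈ D ∧ (q.2.2 : ℝ) ≤ q.1}
  have hT : MeasurableSet T :=
    (measurable_fst.comp measurable_snd hD).inter
      (measurableSet_le (by fun_prop) measurable_fst)
  have h : Measurable (T.indicator fun q => (q.2.1 : ℝ)) := Measurable.indicator (by fun_prop) hT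
  convert h using 1
  ext q
  by_cases hq : q ∈ T
  · rw [indicator_of_mem hq]
    exact indicator_of_mem (s := D ×ˢ {u : Ioi (0 : ℝ) | (u : ℝ) ≤ q.1}) hq _
  · rw [indicator_of_notMem hq]
    exact indicator_of_notMem (s := D ×ˢ {u : Ioi (0 : ℝ) | (u : ℝ) ≤ q.1}) hq _

section
variable {γ : Measure (Ioi (0 : ℝ))}

theorem integral_comp_cutoffJump [SigmaFinite γ] {D : Set (Ioi (0 : ℝ))}
    (hD : MeasurableSet D) {x : ℝ} (hx : 0 ≤ x) {k : ℝ → ℝ} (hk : k 0 = 0) :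
    ∫ p, k (cutoffJump D x p) ∂(γ.prod lebesguePos) = x * ∫ z in D, k z ∂γ := by
  have h : ∀ p, k (cutoffJump D x p) = (D ×ˢ {u : Ioi (0 : ℝ) | (u : ℝ) ≤ x}).indicator
      (fun p => k (p.1 : ℝ) * 1) p := fun p => by
    unfold cutoffJump
    by_cases hp : p ∈ D ×ˢ {u : Ioi (0 : ℝ) | (u : ℝ) ≤ x}
    · rw [indicator_of_mem hp, indicator_of_mem hp, mul_one]
    · rw [indicator_of_notMem hp, indicator_of_notMem hp, hk]
  simp only [h]
  rw [integral_indicator (hD.prod (measurableSet_coe_le x)),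
    setIntegral_prod_mul (fun z : Ioi (0 : ℝ) => k z) (fun _ => (1 : ℝ)), mul_comm]
  simp [Measure.real, lebesguePos_le, hx]

theorem integrable_cutoffJump [SigmaFinite γ] {D : Set (Ioi (0 : ℝ))} (hD : MeasurableSet D) (x : ℝ)
    (h : IntegrableOn (fun z : Ioi (0 : ℝ) => (z : ℝ)) D γ) :
    Integrable (cutoffJump D x) (γ.prod lebesguePos) := by
  unfold cutoffJump
  rw [integrable_indicator_iff (hD.prod (measurableSet_coe_le x)), IntegrableOn,
    ← Measure.prod_restrict]
  have : IsFiniteMeasure (lebesguePos.restrict {u : Ioi (0 : ℝ) | (u : ℝ) ≤ x}) :=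
    ⟨by rw [Measure.restrict_apply_univ, lebesguePos_le]; exact ENNReal.ofReal_lt_top⟩
  exact h.comp_fst _

theorem integrable_min_sq
    (hγ : ∫⁻ z, ENNReal.ofReal (min (z : ℝ) ((z : ℝ) ^ 2)) ∂γ < ∞) :
    Integrable (fun z : Ioi (0 : ℝ) => min (z : ℝ) ((z : ℝ) ^ 2)) γ :=
  (lintegral_ofReal_ne_top_iff_integrable (by fun_prop)
    (ae_of_all _ fun z => le_min z.2.le (sq_nonneg _))).1 hγ.ne

theorem integrableOn_tail
    (hγ : Integrable (fun z : Ioi (0 : ℝ) => min (z : ℝ) ((z : ℝ) ^ 2)) γ) {a : ℝ} (ha : 0 < a) :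
    IntegrableOn (fun z : Ioi (0 : ℝ) => (z : ℝ)) {z | a < (z : ℝ)} γ := by
  refine Integrable.mono' ((hγ.restrict (s := {z : Ioi (0 : ℝ) | a < (z : ℝ)})).const_mul
    (1 + 1 / a)) measurable_subtype_coe.aestronglyMeasurable ?_
  filter_upwards [ae_restrict_mem (measurableSet_lt_coe a)] with z hz
  have hz0 : (0 : ℝ) < z := z.2
  have hz' : a < (z : ℝ) := hz
  rw [Real.norm_eq_abs, abs_of_pos hz0]
  rcases min_cases (z : ℝ) ((z : ℝ) ^ 2) with ⟨h, _⟩ | ⟨h, _⟩ <;> rw [h]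
  · have : 0 ≤ 1 / a * (z : ℝ) := by positivity
    linarith
  · have h1 : (z : ℝ) ≤ 1 / a * (z : ℝ) ^ 2 := by
      rw [div_mul_eq_mul_div, le_div_iff₀ ha]
      nlinarith
    nlinarith [sq_nonneg (z : ℝ)]

theorem integrable_expRemainder_mul
    (hγ : Integrable (fun z : Ioi (0 : ℝ) => min (z : ℝ) ((z : ℝ) ^ 2)) γ) {l : ℝ} (hl : 0 ≤ l) :
    Integrable (fun z : Ioi (0 : ℝ) => expRemainder (l * z)) γ := by
  refine (hγ.const_mul (l + l ^ 2)).mono'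
    (measurable_expRemainder.comp (by fun_prop)).aestronglyMeasurable (ae_of_all _ fun z => ?_)
  have hz0 : (0 : ℝ) < z := z.2
  have hlz : 0 ≤ l * (z : ℝ) := by positivity
  rw [Real.norm_eq_abs, abs_of_nonneg (expRemainder_nonneg _)]
  rcases min_cases (z : ℝ) ((z : ℝ) ^ 2) with ⟨h, _⟩ | ⟨h, _⟩ <;> rw [h]
  · refine (expRemainder_le_self hlz).trans ?_
    nlinarith [mul_nonneg (sq_nonneg l) hz0.le]
  · refine (expRemainder_le_sq hlz).trans ?_
    nlinarith [mul_nonneg hl (sq_nonneg (z : ℝ))]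

theorem tendsto_setIntegral_le_zero {k : Ioi (0 : ℝ) → ℝ} (hk : Integrable k γ) :
    Tendsto (fun a : ℝ => ∫ z in {z : Ioi (0 : ℝ) | (z : ℝ) ≤ a}, k z ∂γ) (𝓝[>] 0) (𝓝 0) := by
  simp only [← integral_indicator (measurableSet_coe_le _)]
  suffices h : Tendsto (fun a : ℝ => ∫ z, {z : Ioi (0 : ℝ) | (z : ℝ) ≤ a}.indicator k z ∂γ)
      (𝓝[>] 0) (𝓝 (∫ _ : Ioi (0 : ℝ), (0 : ℝ) ∂γ)) by simpa using h
  refine tendsto_integral_filter_of_dominated_convergence (fun z => ‖k z‖)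
    (Eventually.of_forall fun a => hk.aestronglyMeasurable.indicator (measurableSet_coe_le a))
    (Eventually.of_forall fun a => ae_of_all _ fun z => norm_indicator_le_norm_self _ _) hk.norm
    (ae_of_all _ fun z => ?_)
  refine tendsto_const_nhds.congr' ?_
  have hz0 : (0 : ℝ) < z := z.2
  filter_upwards [nhdsWithin_le_nhds (gt_mem_nhds hz0)] with a ha
  rw [indicator_of_notMem]
  simpa using ha
end

/-! ### The limit of the truncated integrals -/

/-- The compensated integral of `z` over the jumps `z > a` at heights `u ≤ x`. -/
noncomputable def truncatedJumpIntegral (γ : Measure (Ioi (0 : ℝ))) (a x : ℝ)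
    (s : ℕ → ℕ × (ℕ → Ioi (0 : ℝ) × Ioi (0 : ℝ))) : ℝ :=
  compensated (γ.prod lebesguePos) (cutoffJump {z | a < (z : ℝ)} x) s

theorem tendsto_exp_setIntegral_sub_one {γ : Measure (Ioi (0 : ℝ))}
    {k : Ioi (0 : ℝ) → ℝ} (hk : Integrable k γ) (x : ℝ)
    {D : ℝ≥0∞} (hD : D ≠ 0) :
    Tendsto (fun a : ℝ => ENNReal.ofReal (Real.exp
      (x * ∫ z in {z : Ioi (0 : ℝ) | (z : ℝ) ≤ a}, k z ∂γ) - 1) / D) (𝓝[>] 0) (𝓝 0) := by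
  have h1 : Tendsto (fun a : ℝ => Real.exp
      (x * ∫ z in {z : Ioi (0 : ℝ) | (z : ℝ) ≤ a}, k z ∂γ) - 1) (𝓝[>] 0)
      (𝓝 (Real.exp (x * 0) - 1)) :=
    ((Real.continuous_exp.tendsto _).comp
      ((tendsto_setIntegral_le_zero hk).const_mul x)).sub_const 1
  have h2 := ENNReal.Tendsto.div_const (ENNReal.tendsto_ofReal h1) (b := D) (.inr hD)
  simpa using h2

theorem measurable_truncatedJumpIntegral_right (γ : Measure (Ioi (0 : ℝ)))
    (a x : ℝ) :
    Measurable (truncatedJumpIntegral γ a x) :=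
  (measurable_integral_pointMeasure (measurable_cutoffJump (measurableSet_lt_coe a) x)
    (cutoffJump_nonneg _ x)).sub_const _

/-- Truncation levels along which the truncated integrals converge almost surely, for all values
of the height `x`: the bound involves the height `k` at stage `k`, which eventually exceeds `x`. -/
theorem exists_truncation_levels {γ : Measure (Ioi (0 : ℝ))}
    (hγ : Integrable (fun z : Ioi (0 : ℝ) => min (z : ℝ) ((z : ℝ) ^ 2)) γ) :
    ∃ a : ℕ → ℝ, (∀ k, 0 < a k) ∧ Antitone a ∧ Tendsto a atTop (𝓝[>] 0) ∧
      ∀ k : ℕ, ENNReal.ofReal (Real.exp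
        (k * ∫ z in {z : Ioi (0 : ℝ) | (z : ℝ) ≤ a k}, expRemainder z ∂γ) - 1) /
        ENNReal.ofReal (expRemainder ((1 / 2) ^ k)) ≤ (1 / 2) ^ k := by
  have hint : Integrable (fun z : Ioi (0 : ℝ) => expRemainder z) γ := by
    simpa using integrable_expRemainder_mul hγ zero_le_one
  have h1 : ∀ k : ℕ, ∃ b : ℝ, 0 < b ∧ ∀ a, 0 < a → a ≤ b → ENNReal.ofReal (Real.exp
      (k * ∫ z in {z : Ioi (0 : ℝ) | (z : ℝ) ≤ a}, expRemainder z ∂γ) - 1) /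
      ENNReal.ofReal (expRemainder ((1 / 2) ^ k)) ≤ (1 / 2) ^ k := fun k => by
    have hpos : 0 < expRemainder ((1 / 2) ^ k) := expRemainder_pos (by positivity)
    have h := (tendsto_exp_setIntegral_sub_one hint k
      (D := ENNReal.ofReal (expRemainder ((1 / 2) ^ k))) (by simpa using hpos)).eventually_le_const
      (show (0 : ℝ≥0∞) < (1 / 2) ^ k from ENNReal.pow_pos (by simp) k)
    obtain ⟨b, hb, hb'⟩ := mem_nhdsGT_iff_exists_Ioc_subset.1 h
    exact ⟨b, hb, fun a ha hab => hb' ⟨ha, hab⟩⟩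
  choose b hb0 hb using h1
  -- the running minimum of the levels `b k` and `1 / (k + 1)`
  let a : ℕ → ℝ := fun k => (Finset.range (k + 1)).inf' ⟨0, by simp⟩
    fun j => min (b j) (1 / ((j : ℝ) + 1))
  have ha0 : ∀ k, 0 < a k := fun k => by
    refine (Finset.lt_inf'_iff _).2 fun j _ => lt_min (hb0 j) (by positivity)
  have hale : ∀ k, a k ≤ min (b k) (1 / ((k : ℝ) + 1)) := fun k =>
    Finset.inf'_le _ (by simp)
  refine ⟨a, ha0, fun j k hjk => Finset.inf'_mono _ (Finset.range_mono (by lia)) _, ?_,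
    fun k => hb k _ (ha0 k) ((hale k).trans (min_le_left _ _))⟩
  refine tendsto_nhdsWithin_iff.2 ⟨?_, Eventually.of_forall ha0⟩
  exact squeeze_zero (fun k => (ha0 k).le) (fun k => (hale k).trans (min_le_right _ _))
    tendsto_one_div_add_atTop_nhds_zero_nat

section
variable {γ : Measure (Ioi (0 : ℝ))} [SigmaFinite γ]

theorem measurable_truncatedJumpIntegral (a : ℝ) :
    Measurable fun q : ℝ × (ℕ → ℕ × (ℕ → Ioi (0 : ℝ) × Ioi (0 : ℝ))) =>
      truncatedJumpIntegral γ a q.1 q.2 := by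
  have hm := measurable_cutoffJump_uncurry (measurableSet_lt_coe a)
  unfold truncatedJumpIntegral compensated
  simp only [integral_pointMeasure_of_nonneg (measurable_cutoffJump (measurableSet_lt_coe a) _)
    (cutoffJump_nonneg _ _)]
  refine (measurable_lintegral_pointMeasure hm.ennreal_ofReal).ennreal_toReal.sub ?_
  have h : Measurable fun x : ℝ =>
      ∫ p, cutoffJump {z : Ioi (0 : ℝ) | a < (z : ℝ)} x p ∂(γ.prod lebesguePos) :=
    (hm.stronglyMeasurable.integral_prod_right').measurable
  exact h.comp measurable_fst

variable {r : ℕ → ℝ≥0} {ν : ℕ → Measure (Ioi (0 : ℝ) × Ioi (0 : ℝ))}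
  [∀ n, IsProbabilityMeasure (ν n)]

theorem lintegral_exp_truncatedJumpIntegral
    (hμ : (Measure.sum fun n => r n • ν n) = γ.prod lebesguePos)
    (hγ : Integrable (fun z : Ioi (0 : ℝ) => min (z : ℝ) ((z : ℝ) ^ 2)) γ)
    {a x l : ℝ} (ha : 0 < a) (hx : 0 ≤ x) (hl : 0 ≤ l) :
    ∫⁻ s, ENNReal.ofReal (Real.exp (-l * truncatedJumpIntegral γ a x s)) ∂(poissonLaw r ν) =
      ENNReal.ofReal (Real.exp
        (x * ∫ z in {z : Ioi (0 : ℝ) | a < (z : ℝ)}, expRemainder (l * z) ∂γ)) := by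
  obtain ⟨h1, h2⟩ := integral_exp_compensated r ν hμ
    (measurable_cutoffJump (measurableSet_lt_coe a) x) (cutoffJump_nonneg _ x)
    (integrable_cutoffJump (measurableSet_lt_coe a) x (integrableOn_tail hγ ha)) hl
  unfold truncatedJumpIntegral
  rw [← ofReal_integral_eq_lintegral_ofReal h1 (ae_of_all _ fun s => (Real.exp_pos _).le), h2,
    integral_comp_cutoffJump (measurableSet_lt_coe a) hx (k := fun y => expRemainder (l * y))
    (by simp [expRemainder_zero])]

theorem ae_truncatedJumpIntegral_sub
    (hμ : (Measure.sum fun n => r n • ν n) = γ.prod lebesguePos)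
    (hγ : Integrable (fun z : Ioi (0 : ℝ) => min (z : ℝ) ((z : ℝ) ^ 2)) γ)
    {a b : ℝ} (ha : 0 < a) (hab : a ≤ b) (x : ℝ) :
    ∀ᵐ s ∂(poissonLaw r ν), truncatedJumpIntegral γ a x s - truncatedJumpIntegral γ b x s =
      compensated (γ.prod lebesguePos)
        (cutoffJump ({z | a < (z : ℝ)} ∩ {z | (z : ℝ) ≤ b}) x) s := by
  have hDm : MeasurableSet ({z : Ioi (0 : ℝ) | a < (z : ℝ)} ∩ {z | (z : ℝ) ≤ b}) :=
    (measurableSet_lt_coe a).inter (measurableSet_coe_le b)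
  have h1 := integrable_cutoffJump (γ := γ) (measurableSet_lt_coe b) x
    (integrableOn_tail hγ (ha.trans_le hab))
  have h2 := integrable_cutoffJump (γ := γ) hDm x
    ((integrableOn_tail hγ ha).mono_set inter_subset_left)
  have hadd : cutoffJump {z : Ioi (0 : ℝ) | a < (z : ℝ)} x = fun p =>
      cutoffJump {z : Ioi (0 : ℝ) | b < (z : ℝ)} x p +
        cutoffJump ({z : Ioi (0 : ℝ) | a < (z : ℝ)} ∩ {z | (z : ℝ) ≤ b}) x p := by
    have hdisj : Disjoint ({z : Ioi (0 : ℝ) | b < (z : ℝ)} ×ˢ {u : Ioi (0 : ℝ) | (u : ℝ) ≤ x})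
        (({z : Ioi (0 : ℝ) | a < (z : ℝ)} ∩ {z | (z : ℝ) ≤ b}) ×ˢ
          {u : Ioi (0 : ℝ) | (u : ℝ) ≤ x}) :=
      Set.disjoint_left.2 fun p hp hq => (not_le.2 (show b < (p.1 : ℝ) from hp.1)) hq.1.2
    unfold cutoffJump
    rw [← indicator_union_of_disjoint hdisj, ← union_prod]
    congr 2
    ext z
    simp only [mem_union, mem_inter_iff]
    exact ⟨fun h => (lt_or_ge b (z : ℝ)).imp id fun h' => ⟨h, h'⟩,
      fun h => h.elim (fun h => hab.trans_lt h) And.left⟩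
  filter_upwards [ae_integrable_pointMeasure r ν (measurable_cutoffJump (measurableSet_lt_coe b) x)
    (hμ ▸ h1), ae_integrable_pointMeasure r ν (measurable_cutoffJump hDm x) (hμ ▸ h2)]
    with s hs1 hs2
  unfold truncatedJumpIntegral compensated
  rw [hadd, integral_add hs1 hs2, integral_add h1 h2]
  ring

theorem lintegral_expRemainder_truncatedJumpIntegral_sub
    (hμ : (Measure.sum fun n => r n • ν n) = γ.prod lebesguePos)
    (hγ : Integrable (fun z : Ioi (0 : ℝ) => min (z : ℝ) ((z : ℝ) ^ 2)) γ)
    {a b c x : ℝ} (ha : 0 < a) (hab : a ≤ b) (hbc : b ≤ c) (hx : 0 ≤ x) :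
    ∫⁻ s, ENNReal.ofReal (expRemainder
        (truncatedJumpIntegral γ a x s - truncatedJumpIntegral γ b x s)) ∂(poissonLaw r ν) ≤
      ENNReal.ofReal (Real.exp
        (x * ∫ z in {z : Ioi (0 : ℝ) | (z : ℝ) ≤ c}, expRemainder z ∂γ) - 1) := by
  have hDm : MeasurableSet ({z : Ioi (0 : ℝ) | a < (z : ℝ)} ∩ {z | (z : ℝ) ≤ b}) :=
    (measurableSet_lt_coe a).inter (measurableSet_coe_le b)
  have h2 := integrable_cutoffJump (γ := γ) hDm x
    ((integrableOn_tail hγ ha).mono_set inter_subset_left)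
  rw [lintegral_congr_ae ((ae_truncatedJumpIntegral_sub hμ hγ ha hab x).mono fun s hs =>
    congrArg (fun y => ENNReal.ofReal (expRemainder y)) hs),
    lintegral_expRemainder_compensated r ν hμ (measurable_cutoffJump hDm x)
      (cutoffJump_nonneg _ x) h2, integral_comp_cutoffJump hDm hx expRemainder_zero]
  gcongr
  · exact ae_of_all _ fun z => expRemainder_nonneg _
  · simpa using (integrable_expRemainder_mul hγ zero_le_one).restrict
  · exact fun z hz => hz.2.trans hbc

/-- A Chebyshev inequality for the difference of two truncated integrals, with `expRemainder` in
place of the square. -/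
theorem measure_truncatedJumpIntegral_sub_le
    (hμ : (Measure.sum fun n => r n • ν n) = γ.prod lebesguePos)
    (hγ : Integrable (fun z : Ioi (0 : ℝ) => min (z : ℝ) ((z : ℝ) ^ 2)) γ)
    {a b c x δ : ℝ} (ha : 0 < a) (hb : 0 < b) (hac : a ≤ c) (hbc : b ≤ c) (hx : 0 ≤ x)
    (hδ : 0 < δ) :
    poissonLaw r ν {s | δ ≤ |truncatedJumpIntegral γ a x s - truncatedJumpIntegral γ b x s|} ≤
      ENNReal.ofReal (Real.exp
        (x * ∫ z in {z : Ioi (0 : ℝ) | (z : ℝ) ≤ c}, expRemainder z ∂γ) - 1) /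
        ENNReal.ofReal (expRemainder δ) := by
  have hm : ∀ a, Measurable (truncatedJumpIntegral γ a x) := fun a =>
    measurable_truncatedJumpIntegral_right γ a x
  wlog hab : a ≤ b generalizing a b
  · simp only [abs_sub_comm (truncatedJumpIntegral γ a x _)]
    exact this hb ha hbc hac (le_of_not_ge hab)
  refine (measure_le_abs_le_lintegral_expRemainder _ ((hm a).sub (hm b)).aemeasurable hδ).trans ?_
  gcongr
  exact lintegral_expRemainder_truncatedJumpIntegral_sub hμ hγ ha hab hbc hx

/-- By the Borel-Cantelli lemma, the truncated integrals converge almost surely along the levels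
of `exists_truncation_levels`. -/
theorem ae_exists_tendsto_truncatedJumpIntegral
    (hμ : (Measure.sum fun n => r n • ν n) = γ.prod lebesguePos)
    (hγ : Integrable (fun z : Ioi (0 : ℝ) => min (z : ℝ) ((z : ℝ) ^ 2)) γ)
    {a : ℕ → ℝ} (ha0 : ∀ k, 0 < a k) (ha : Antitone a)
    (hak : ∀ k : ℕ, ENNReal.ofReal (Real.exp
        (k * ∫ z in {z : Ioi (0 : ℝ) | (z : ℝ) ≤ a k}, expRemainder z ∂γ) - 1) /
        ENNReal.ofReal (expRemainder ((1 / 2) ^ k)) ≤ (1 / 2) ^ k)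
    {x : ℝ} (hx : 0 ≤ x) :
    ∀ᵐ s ∂(poissonLaw r ν), ∃ y,
      Tendsto (fun k => truncatedJumpIntegral γ (a k) x s) atTop (𝓝 y) := by
  -- from the stage `K ≥ x` on, the levels are good for the height `x`
  obtain ⟨K, hK⟩ := exists_nat_ge x
  have hbound : ∀ k, poissonLaw r ν {s | (1 / 2) ^ (k + K) ≤
      |truncatedJumpIntegral γ (a (k + K + 1)) x s - truncatedJumpIntegral γ (a (k + K)) x s|} ≤
      (1 / 2) ^ k := fun k => by
    refine (measure_truncatedJumpIntegral_sub_le hμ hγ (ha0 _) (ha0 _) (ha (Nat.le_succ _)) le_rfl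
      hx (by positivity)).trans ?_
    calc _ ≤ ENNReal.ofReal (Real.exp ((k + K : ℕ) *
          ∫ z in {z : Ioi (0 : ℝ) | (z : ℝ) ≤ a (k + K)}, expRemainder z ∂γ) - 1) /
          ENNReal.ofReal (expRemainder ((1 / 2) ^ (k + K))) := by
          gcongr
          · exact integral_nonneg fun z => expRemainder_nonneg _
          · push_cast
            have : (0 : ℝ) ≤ k := Nat.cast_nonneg k
            linarith
      _ ≤ (1 / 2) ^ (k + K) := hak _
      _ ≤ (1 / 2) ^ k := pow_le_pow_right_of_le_one' (by simp) (Nat.le_add_right _ _)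
  have hsum : ∑' k, poissonLaw r ν {s | (1 / 2) ^ (k + K) ≤
      |truncatedJumpIntegral γ (a (k + K + 1)) x s - truncatedJumpIntegral γ (a (k + K)) x s|}
      ≠ ∞ := by
    refine ne_top_of_le_ne_top ?_ (ENNReal.tsum_le_tsum hbound)
    rw [ENNReal.tsum_geometric]
    simp
  filter_upwards [ae_eventually_notMem hsum] with s hs
  have hc : CauchySeq fun k => truncatedJumpIntegral γ (a (k + K)) x s := by
    refine cauchySeq_of_summable_dist ?_
    refine Summable.of_norm_bounded_eventually_nat (g := fun k : ℕ => (1 / 2 : ℝ) ^ k)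
      (summable_geometric_of_lt_one (by norm_num) (by norm_num)) ?_
    filter_upwards [hs] with k hk
    have hk' : ¬ (1 / 2 : ℝ) ^ (k + K) ≤ |truncatedJumpIntegral γ (a (k + K + 1)) x s -
      truncatedJumpIntegral γ (a (k + K)) x s| := hk
    rw [Real.norm_eq_abs, abs_of_nonneg dist_nonneg, dist_comm, Real.dist_eq,
      show k.succ + K = k + K + 1 by lia]
    exact (not_le.1 hk').le.trans
      (pow_le_pow_of_le_one (by norm_num) (by norm_num) (Nat.le_add_right _ _))
  obtain ⟨y, hy⟩ := cauchySeq_tendsto_of_complete hc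
  exact ⟨y, (tendsto_add_atTop_iff_nat K).1 hy⟩

/-- The compensated integral of `z` over the jumps at heights `u ≤ x` exists as a limit in
probability, jointly measurable in `x` and the sample, with the expected Laplace transform. -/
theorem exists_compensatedJumpIntegral
    (hμ : (Measure.sum fun n => r n • ν n) = γ.prod lebesguePos)
    (hγ : Integrable (fun z : Ioi (0 : ℝ) => min (z : ℝ) ((z : ℝ) ^ 2)) γ) :
    ∃ W : ℝ × (ℕ → ℕ × (ℕ → Ioi (0 : ℝ) × Ioi (0 : ℝ))) → ℝ, Measurable W ∧
      (∀ x, 0 ≤ x → ∀ δ, 0 < δ → Tendsto (fun ε => poissonLaw r ν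
        {s | δ ≤ |truncatedJumpIntegral γ ε x s - W (x, s)|}) (𝓝[>] 0) (𝓝 0)) ∧
      ∀ x, 0 ≤ x → ∀ l, 0 ≤ l →
        ∫⁻ s, ENNReal.ofReal (Real.exp (-l * W (x, s))) ∂(poissonLaw r ν) =
          ENNReal.ofReal (Real.exp (x * ∫ z, expRemainder (l * z) ∂γ)) := by
  obtain ⟨a, ha0, hanti, hatend, hak⟩ := exists_truncation_levels hγ
  have hint : Integrable (fun z : Ioi (0 : ℝ) => expRemainder z) γ := by
    simpa using integrable_expRemainder_mul hγ zero_le_one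
  let W : ℝ × (ℕ → ℕ × (ℕ → Ioi (0 : ℝ) × Ioi (0 : ℝ))) → ℝ := fun q =>
    limsup (fun k => truncatedJumpIntegral γ (a k) q.1 q.2) atTop
  have hWm : Measurable W := Measurable.limsup fun k => measurable_truncatedJumpIntegral (a k)
  have hm : ∀ a x, Measurable (truncatedJumpIntegral γ a x) :=
    measurable_truncatedJumpIntegral_right γ
  have hconv : ∀ x, 0 ≤ x → ∀ᵐ s ∂(poissonLaw r ν),
      Tendsto (fun k => truncatedJumpIntegral γ (a k) x s) atTop (𝓝 (W (x, s))) := fun x hx => by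
    filter_upwards [ae_exists_tendsto_truncatedJumpIntegral hμ hγ ha0 hanti hak hx] with s hs
    obtain ⟨y, hy⟩ := hs
    have : W (x, s) = y := hy.limsup_eq
    rwa [this]
  refine ⟨W, hWm, fun x hx δ hδ => ?_, fun x hx l hl => ?_⟩
  · have hpos : ENNReal.ofReal (expRemainder δ) ≠ 0 := by simpa using expRemainder_pos hδ.ne'
    have hWx : Measurable fun s => W (x, s) := hWm.comp measurable_prodMk_left
    refine tendsto_of_tendsto_of_tendsto_of_le_of_le' tendsto_const_nhds
      (tendsto_exp_setIntegral_sub_one hint x hpos) (Eventually.of_forall fun _ => zero_le) ?_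
    filter_upwards [self_mem_nhdsWithin] with ε hε
    have hε0 : 0 < ε := hε
    simp only [abs_sub_comm (truncatedJumpIntegral γ ε x _)]
    refine (measure_le_abs_le_lintegral_expRemainder _
      (hWx.sub (hm ε x)).aemeasurable hδ).trans ?_
    gcongr
    calc ∫⁻ s, ENNReal.ofReal (expRemainder (W (x, s) - truncatedJumpIntegral γ ε x s))
          ∂(poissonLaw r ν)
        = ∫⁻ s, liminf (fun k => ENNReal.ofReal (expRemainder
            (truncatedJumpIntegral γ (a k) x s - truncatedJumpIntegral γ ε x s))) atTop
            ∂(poissonLaw r ν) := by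
          refine lintegral_congr_ae ((hconv x hx).mono fun s hs => ?_)
          exact ((ENNReal.continuous_ofReal.comp continuous_expRemainder).tendsto _ |>.comp
            (hs.sub_const _)).liminf_eq.symm
      _ ≤ liminf (fun k => ∫⁻ s, ENNReal.ofReal (expRemainder
            (truncatedJumpIntegral γ (a k) x s - truncatedJumpIntegral γ ε x s))
            ∂(poissonLaw r ν)) atTop :=
          lintegral_liminf_le fun k => (measurable_expRemainder.comp
            ((hm _ x).sub (hm ε x))).ennreal_ofReal
      _ ≤ _ := by
          refine liminf_le_of_frequently_le' (Eventually.frequently ?_)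
          filter_upwards [(tendsto_nhdsWithin_iff.1 hatend).1.eventually_le_const hε0] with k hk
          exact lintegral_expRemainder_truncatedJumpIntegral_sub hμ hγ (ha0 k) hk le_rfl hx
  · have hmono : ∀ (l : ℝ) (_ : 0 ≤ l) (a : ℝ),
        ∫ z in {z : Ioi (0 : ℝ) | a < (z : ℝ)}, expRemainder (l * z) ∂γ =
          ∫ z, expRemainder (l * z) ∂γ -
            ∫ z in {z : Ioi (0 : ℝ) | (z : ℝ) ≤ a}, expRemainder (l * z) ∂γ := fun l hl a => by
      rw [← integral_add_compl (measurableSet_coe_le a) (integrable_expRemainder_mul hγ hl),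
        add_sub_cancel_left]
      congr 2
      ext z
      simp
    refine lintegral_eq_of_tendsto_of_lintegral_sq_le (poissonLaw r ν)
      (y := fun k s => ENNReal.ofReal (Real.exp (-l * truncatedJumpIntegral γ (a k) x s)))
      (C := ENNReal.ofReal (Real.exp (x * ∫ z, expRemainder (2 * l * z) ∂γ)))
      (fun k => ((hm _ x).const_mul (-l)).exp.ennreal_ofReal) ?_ ENNReal.ofReal_ne_top
      (fun k => ?_) ?_
    · filter_upwards [hconv x hx] with s hs
      exact ENNReal.tendsto_ofReal ((Real.continuous_exp.tendsto _).comp (hs.const_mul (-l)))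
    · -- the square of `e^{-lI}` is the exponential at `2l`
      have h2l : (0 : ℝ) ≤ 2 * l := by positivity
      have h : ∀ s, ENNReal.ofReal (Real.exp (-l * truncatedJumpIntegral γ (a k) x s)) ^ 2 =
          ENNReal.ofReal (Real.exp (-(2 * l) * truncatedJumpIntegral γ (a k) x s)) := fun s => by
        rw [← ENNReal.ofReal_pow (Real.exp_pos _).le, ← Real.exp_nat_mul]
        congr 2
        push_cast
        ring
      simp only [h]
      rw [lintegral_exp_truncatedJumpIntegral hμ hγ (ha0 k) hx h2l]
      gcongr
      · exact ae_of_all _ fun z => expRemainder_nonneg _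
      · exact integrable_expRemainder_mul hγ h2l
      · exact Measure.restrict_le_self
    · simp only [lintegral_exp_truncatedJumpIntegral hμ hγ (ha0 _) hx hl, hmono l hl]
      have h := ((tendsto_setIntegral_le_zero (integrable_expRemainder_mul hγ hl)).comp
        hatend).const_sub (∫ z, expRemainder (l * z) ∂γ)
      rw [sub_zero] at h
      exact ENNReal.tendsto_ofReal ((Real.continuous_exp.tendsto _).comp (h.const_mul x))
end

/-! ### Coupling by disintegration -/

section
variable {Ω S : Type*} {G : MeasurableSpace Ω} [F : MeasurableSpace Ω] [MeasurableSpace S]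
  {P : Measure Ω} [IsProbabilityMeasure P] {Q : Measure S} [IsProbabilityMeasure Q]
  {ξ Z : Ω → ℝ} {V : ℝ × S → ℝ} {ψ : ℝ → ℝ}

/-- If `Z`, given `G`, and `V (x, ·)` at `x = ξ` have the same Laplace transform, then `Z` and
`V (ξ, ·)` have the same law on each event of `G` on which `ξ` is bounded. -/
theorem map_restrict_eq_map_prod_of_le (hG : G ≤ F) (hξ : Measurable ξ) (hξ0 : ∀ ω, 0 ≤ ξ ω)
    (hZ : Measurable Z) (hV : Measurable V)
    (hlap : ∀ A, MeasurableSet[G] A → ∀ l : ℝ, 0 ≤ l →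
      ∫⁻ ω in A, ENNReal.ofReal (Real.exp (-l * Z ω)) ∂P =
        ∫⁻ ω in A, ENNReal.ofReal (Real.exp (ξ ω * ψ l)) ∂P)
    (hVlap : ∀ x, 0 ≤ x → ∀ l, 0 ≤ l →
      ∫⁻ s, ENNReal.ofReal (Real.exp (-l * V (x, s))) ∂Q = ENNReal.ofReal (Real.exp (x * ψ l)))
    {A : Set Ω} (hA : MeasurableSet[G] A) {c : ℝ} (hc : ∀ ω ∈ A, ξ ω ≤ c) :
    (P.restrict A).map Z = ((P.restrict A).prod Q).map fun q => V (ξ q.1, q.2) := by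
  have hVξ : Measurable fun q : Ω × S => V (ξ q.1, q.2) := by fun_prop
  have h1 : ∀ l : ℝ, 0 ≤ l → ∫⁻ z, ENNReal.ofReal (Real.exp (-l * z)) ∂((P.restrict A).map Z) =
      ∫⁻ ω in A, ENNReal.ofReal (Real.exp (ξ ω * ψ l)) ∂P := fun l hl => by
    rw [lintegral_map (by fun_prop) hZ, hlap A hA l hl]
  have h2 : ∀ l : ℝ, 0 ≤ l → ∫⁻ z, ENNReal.ofReal (Real.exp (-l * z))
      ∂(((P.restrict A).prod Q).map fun q => V (ξ q.1, q.2)) =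
      ∫⁻ ω in A, ENNReal.ofReal (Real.exp (ξ ω * ψ l)) ∂P := fun l hl => by
    rw [lintegral_map (by fun_prop) hVξ, lintegral_prod _ (by fun_prop)]
    exact lintegral_congr fun ω => hVlap _ (hξ0 ω) l hl
  refine Measure.ext_of_lintegral_exp_neg_eq (fun l hl => ?_)
    fun l hl => (h1 l hl).trans (h2 l hl).symm
  rw [h1 l hl]
  have hle : ∫⁻ ω in A, ENNReal.ofReal (Real.exp (ξ ω * ψ l)) ∂P ≤
      ∫⁻ _ in A, ENNReal.ofReal (Real.exp (c * |ψ l|)) ∂P := by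
    refine setLIntegral_mono' (hG A hA) fun ω hω => ?_
    gcongr ENNReal.ofReal (Real.exp ?_)
    exact (mul_le_mul_of_nonneg_left (le_abs_self _) (hξ0 ω)).trans
      (mul_le_mul_of_nonneg_right (hc ω hω) (abs_nonneg _))
  refine ne_top_of_le_ne_top ?_ hle
  simpa using ENNReal.mul_ne_top ENNReal.ofReal_ne_top (measure_ne_top P A)

/-- The joint law of `ξ` and `Z` on an event of `G`. The bound on `ξ` is removed by cutting `ℝ × ℝ`
into the sets where the first coordinate is at most `n`. -/
theorem map_restrict_prodMk_eq (hG : G ≤ F) (hξ : Measurable[G] ξ) (hξ0 : ∀ ω, 0 ≤ ξ ω)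
    (hZ : Measurable Z) (hV : Measurable V)
    (hlap : ∀ A, MeasurableSet[G] A → ∀ l : ℝ, 0 ≤ l →
      ∫⁻ ω in A, ENNReal.ofReal (Real.exp (-l * Z ω)) ∂P =
        ∫⁻ ω in A, ENNReal.ofReal (Real.exp (ξ ω * ψ l)) ∂P)
    (hVlap : ∀ x, 0 ≤ x → ∀ l, 0 ≤ l →
      ∫⁻ s, ENNReal.ofReal (Real.exp (-l * V (x, s))) ∂Q = ENNReal.ofReal (Real.exp (x * ψ l)))
    {A : Set Ω} (hA : MeasurableSet[G] A) :
    (P.restrict A).map (fun ω => (ξ ω, Z ω)) =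
      ((P.restrict A).prod Q).map fun q => (ξ q.1, V (ξ q.1, q.2)) := by
  have hξF : Measurable ξ := hξ.mono hG le_rfl
  have hξZ : Measurable fun ω => (ξ ω, Z ω) := hξF.prodMk hZ
  have hVξ : Measurable fun q : Ω × S => V (ξ q.1, q.2) := by fun_prop
  have hξV : Measurable fun q : Ω × S => (ξ q.1, V (ξ q.1, q.2)) := by fun_prop
  have hcover : ⋃ n : ℕ, Iic (n : ℝ) ×ˢ (univ : Set ℝ) = univ := by
    ext p
    simpa using exists_nat_ge p.1
  refine (Measure.ext_iff_of_iUnion_eq_univ hcover).2 fun n =>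
    Measure.ext_prod fun {D B} hD hB => ?_
  have hDn : MeasurableSet (D ∩ Iic (n : ℝ)) := hD.inter measurableSet_Iic
  have hA' : MeasurableSet[G] (A ∩ ξ ⁻¹' (D ∩ Iic (n : ℝ))) := hA.inter (hξ hDn)
  have h := congrArg (fun m => m B) (map_restrict_eq_map_prod_of_le hG hξF hξ0 hZ hV hlap hVlap hA'
    (c := n) fun ω hω => hω.2.2)
  rw [Measure.map_apply hZ hB, Measure.map_apply hVξ hB, Measure.restrict_apply (hZ hB)] at h
  rw [Measure.restrict_apply (hD.prod hB), Measure.restrict_apply (hD.prod hB), prod_inter_prod,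
    inter_univ, Measure.map_apply hξZ (hDn.prod hB), Measure.map_apply hξV (hDn.prod hB),
    Measure.restrict_apply (hξZ (hDn.prod hB))]
  have e1 : (fun ω => (ξ ω, Z ω)) ⁻¹' ((D ∩ Iic (n : ℝ)) ×ˢ B) ∩ A =
      Z ⁻¹' B ∩ (A ∩ ξ ⁻¹' (D ∩ Iic (n : ℝ))) := by
    ext ω
    simp only [mem_inter_iff, mem_preimage, mem_prod]
    tauto
  rw [e1, h, Measure.prod_apply (hVξ hB), Measure.prod_apply (hξV (hDn.prod hB)),
    ← lintegral_indicator (hG _ hA'), ← lintegral_indicator (hG _ hA)]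
  refine lintegral_congr fun ω => ?_
  by_cases hωA : ω ∈ A
  · by_cases hωD : ξ ω ∈ D ∩ Iic (n : ℝ)
    · rw [indicator_of_mem hωA,
        indicator_of_mem (show ω ∈ A ∩ ξ ⁻¹' (D ∩ Iic (n : ℝ)) from ⟨hωA, hωD⟩)]
      congr 1
      ext s
      simp only [mem_preimage, mem_prod, hωD, true_and]
    · rw [indicator_of_mem hωA, indicator_of_notMem fun hh => hωD hh.2]
      symm
      convert measure_empty (μ := Q)
      ext s
      simp only [mem_preimage, mem_prod, hωD, false_and, mem_empty_iff_false]
  · rw [indicator_of_notMem hωA, indicator_of_notMem fun hh => hωA hh.1]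

/-- Coupling by disintegration. Resampling the element of `S` from its conditional law under `Q`
given `V (x, ·) = z`, at `x = ξ` and `z = Z`, yields an element of `S` of law `Q` that is
independent of `G` and satisfies `Z = V (ξ, ·)`. -/
theorem exists_kernel_compProd_eq [StandardBorelSpace S] [Nonempty S]
    (hG : G ≤ F) (hξ : Measurable[G] ξ) (hξ0 : ∀ ω, 0 ≤ ξ ω)
    (hZ : Measurable Z) (hV : Measurable V)
    (hlap : ∀ A, MeasurableSet[G] A → ∀ l : ℝ, 0 ≤ l →
      ∫⁻ ω in A, ENNReal.ofReal (Real.exp (-l * Z ω)) ∂P =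
        ∫⁻ ω in A, ENNReal.ofReal (Real.exp (ξ ω * ψ l)) ∂P)
    (hVlap : ∀ x, 0 ≤ x → ∀ l, 0 ≤ l →
      ∫⁻ s, ENNReal.ofReal (Real.exp (-l * V (x, s))) ∂Q = ENNReal.ofReal (Real.exp (x * ψ l))) :
    ∃ (κ : Kernel Ω S) (_ : IsMarkovKernel κ), ∀ A, MeasurableSet[G] A →
      ∀ T : Set ((ℝ × ℝ) × S), MeasurableSet T →
        (P ⊗ₘ κ) (Prod.fst ⁻¹' A ∩ {q | ((ξ q.1, Z q.1), q.2) ∈ T}) =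
          ∫⁻ ω in A, Q {s | ((ξ ω, V (ξ ω, s)), s) ∈ T} ∂P := by
  have hξF : Measurable ξ := hξ.mono hG le_rfl
  have hξZ : Measurable fun ω => (ξ ω, Z ω) := hξF.prodMk hZ
  have hξV : Measurable fun q : Ω × S => (ξ q.1, V (ξ q.1, q.2)) := by fun_prop
  have hgraph : Measurable fun q : ℝ × S => (V q, q.2) := by fun_prop
  -- `K x` is the law of `(V (x, s), s)` under `Q`
  let K : Kernel ℝ (ℝ × S) := (Kernel.id ×ₖ Kernel.const ℝ Q).map fun q => (V q, q.2)
  have : IsMarkovKernel K := Kernel.IsMarkovKernel.map _ hgraph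
  have hK : ∀ x, K x = Q.map fun s => (V (x, s), s) := fun x => by
    rw [Kernel.map_apply _ hgraph, Kernel.prod_apply, Kernel.id_apply, Kernel.const_apply,
      Measure.dirac_prod, Measure.map_map hgraph measurable_prodMk_left]
    rfl
  let ρ : Kernel (ℝ × ℝ) S := K.condKernel
  let κ : Kernel Ω S := ρ.comap (fun ω => (ξ ω, Z ω)) hξZ
  refine ⟨κ, inferInstance, fun A hA T hT => ?_⟩
  have hAF := hG A hA
  have hTξ : MeasurableSet {q : Ω × S | ((ξ q.1, Z q.1), q.2) ∈ T} :=
    (by fun_prop : Measurable fun q : Ω × S => ((ξ q.1, Z q.1), q.2)) hT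
  have hρ : Measurable fun p : ℝ × ℝ => ρ p (Prod.mk p ⁻¹' T) :=
    Kernel.measurable_kernel_prodMk_left hT
  have hstep : (P ⊗ₘ κ) (Prod.fst ⁻¹' A ∩ {q | ((ξ q.1, Z q.1), q.2) ∈ T}) =
      ∫⁻ ω in A, ρ (ξ ω, Z ω) (Prod.mk (ξ ω, Z ω) ⁻¹' T) ∂P := by
    rw [Measure.compProd_apply ((measurable_fst hAF).inter hTξ), ← lintegral_indicator hAF]
    refine lintegral_congr fun ω => ?_
    by_cases hω : ω ∈ A
    · rw [indicator_of_mem hω]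
      congr 1
      ext s
      exact ⟨fun h => h.2, fun h => ⟨hω, h⟩⟩
    · rw [indicator_of_notMem hω]
      convert measure_empty (μ := κ ω)
      ext s
      simp only [mem_preimage, mem_inter_iff, hω, false_and, mem_empty_iff_false]
  have hfib : ∀ x, ∫⁻ s, ρ (x, V (x, s)) (Prod.mk (x, V (x, s)) ⁻¹' T) ∂Q =
      Q {s | ((x, V (x, s)), s) ∈ T} := fun x => by
    have hTx : MeasurableSet {p : ℝ × S | ((x, p.1), p.2) ∈ T} :=
      (by fun_prop : Measurable fun p : ℝ × S => ((x, p.1), p.2)) hT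
    have hVx : Measurable fun s => V (x, s) := by fun_prop
    have hgx : Measurable fun s => (V (x, s), s) := by fun_prop
    have h1 : K x {p : ℝ × S | ((x, p.1), p.2) ∈ T} = Q {s | ((x, V (x, s)), s) ∈ T} := by
      rw [hK, Measure.map_apply hgx hTx]
      rfl
    have h2 : (K.fst ⊗ₖ ρ) x = K x := by rw [K.disintegrate ρ]
    rw [← h1, ← h2, Kernel.compProd_apply hTx, Kernel.fst_apply, hK,
      Measure.map_map measurable_fst hgx]
    have hρx : Measurable fun z => ρ (x, z) (Prod.mk (x, z) ⁻¹' T) :=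
      hρ.comp measurable_prodMk_left
    exact (lintegral_map hρx hVx).symm
  rw [hstep]
  have h2 := lintegral_map (μ := P.restrict A) hρ hξZ
  have h3 : Measurable fun q : Ω × S =>
      ρ (ξ q.1, V (ξ q.1, q.2)) (Prod.mk (ξ q.1, V (ξ q.1, q.2)) ⁻¹' T) := hρ.comp hξV
  rw [← h2, map_restrict_prodMk_eq hG hξ hξ0 hZ hV hlap hVlap hA, lintegral_map hρ hξV,
    lintegral_prod _ h3.aemeasurable]
  exact lintegral_congr fun ω => hfib (ξ ω)
end

/-! ### Representation -/

/-- As `z > 0` everywhere, cutting the integrand at `|H| > ε` amounts to keeping the jumps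
`z > ε`. -/
theorem indicator_abs_gt_eq_cutoffJump {ε : ℝ} (hε : 0 < ε) (x : ℝ) :
    {p : Ioi (0 : ℝ) × Ioi (0 : ℝ) | ε < |if (p.2 : ℝ) ≤ x then (p.1 : ℝ) else 0|}.indicator
      (fun p => if (p.2 : ℝ) ≤ x then (p.1 : ℝ) else 0) = cutoffJump {z | ε < (z : ℝ)} x := by
  have hset : {p : Ioi (0 : ℝ) × Ioi (0 : ℝ) | ε < |if (p.2 : ℝ) ≤ x then (p.1 : ℝ) else 0|} =
      {z : Ioi (0 : ℝ) | ε < (z : ℝ)} ×ˢ {u : Ioi (0 : ℝ) | (u : ℝ) ≤ x} := by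
    ext p
    have hp0 : (0 : ℝ) < p.1 := p.1.2
    change ε < |if (p.2 : ℝ) ≤ x then (p.1 : ℝ) else 0| ↔ ε < (p.1 : ℝ) ∧ (p.2 : ℝ) ≤ x
    by_cases hp : (p.2 : ℝ) ≤ x
    · simp only [hp, if_true, abs_of_pos hp0, and_true]
    · simp only [hp, if_false, abs_zero, and_false, hε.not_gt]
  rw [hset, cutoffJump]
  exact indicator_congr fun p hp => if_pos hp.2

theorem measurableSet_abs_gt (ε x : ℝ) : MeasurableSet
    {p : Ioi (0 : ℝ) × Ioi (0 : ℝ) | ε < |if (p.2 : ℝ) ≤ x then (p.1 : ℝ) else 0|} :=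
  measurableSet_lt measurable_const (Measurable.abs (Measurable.ite
    (measurable_snd (measurableSet_coe_le x)) (by fun_prop) measurable_const))

theorem measurable_lintegral_cutoffJump {D : Set (Ioi (0 : ℝ))} (hD : MeasurableSet D) :
    Measurable fun q : ℝ × (ℕ → ℕ × (ℕ → Ioi (0 : ℝ) × Ioi (0 : ℝ))) =>
      ∫⁻ p, ENNReal.ofReal (cutoffJump D q.1 p) ∂(pointMeasure q.2) :=
  measurable_lintegral_pointMeasure
    (f := fun q : ℝ × (Ioi (0 : ℝ) × Ioi (0 : ℝ)) => ENNReal.ofReal (cutoffJump D q.1 q.2))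
    (measurable_cutoffJump_uncurry hD).ennreal_ofReal

theorem proposition4p4 {Ω : Type*} (G : MeasurableSpace Ω) [F : MeasurableSpace Ω]
    (P : Measure Ω) [IsProbabilityMeasure P] (hG : G ≤ F)
    (ξ Z : Ω → ℝ) (hξ : Measurable[G] ξ) (hξ0 : ∀ ω, 0 ≤ ξ ω) (hZ : Measurable Z)
    (β : ℝ) (γ : Measure (Ioi (0 : ℝ))) [SigmaFinite γ]
    (hγ : ∫⁻ z, ENNReal.ofReal (min (z : ℝ) ((z : ℝ) ^ 2)) ∂γ < ∞)
    -- the conditional Laplace transform, with the conditional expectation of nonnegative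
    -- (possibly non-integrable) random variables
    (hZG : ∀ l : ℝ, 0 ≤ l →
      P⁻[fun ω => ENNReal.ofReal (Real.exp (-l * Z ω)) | G] =ᵐ[P] fun ω =>
        ENNReal.ofReal (Real.exp (ξ ω *
          (β * l + ∫ z, (Real.exp (-l * (z : ℝ)) - 1 + l * (z : ℝ)) ∂γ)))) :
    -- an extension `Ω × S` of the probability space, with law `P(dω) κ(ω, ds)`
    ∃ (S : Type) (_ : MeasurableSpace S) (κ : Kernel Ω S) (_ : IsMarkovKernel κ)
      (N : Ω × S → Measure (Ioi (0 : ℝ) × Ioi (0 : ℝ))) (I : Ω × S → ℝ),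
      IsPoissonRandomMeasure (P ⊗ₘ κ) N (γ.prod lebesguePos) ∧
      -- `N` is independent of (the lift of) `G`
      Indep (MeasurableSpace.comap N inferInstance) (MeasurableSpace.comap Prod.fst G) (P ⊗ₘ κ) ∧
      -- `I = ∫∫ z 1_{u ≤ ξ} Ñ(dz, du)`
      IsCompensatedIntegral (P ⊗ₘ κ) N (γ.prod lebesguePos)
        (fun ω p => if (p.2 : ℝ) ≤ ξ ω.1 then (p.1 : ℝ) else 0) I ∧
      ∀ᵐ ω ∂(P ⊗ₘ κ), Z ω.1 = -β * ξ ω.1 + I ω := by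
  have : Nonempty (Ioi (0 : ℝ)) := ⟨⟨1, mem_Ioi.2 one_pos⟩⟩
  have : StandardBorelSpace (Ioi (0 : ℝ)) := measurableSet_Ioi.standardBorel
  obtain ⟨r, ν, hν, hμ⟩ := exists_eq_sum_smul_probabilityMeasure (γ.prod lebesguePos)
  have hγ' := integrable_min_sq hγ
  obtain ⟨W, hWm, hWlim, hWlap⟩ := exists_compensatedJumpIntegral (r := r) (ν := ν) hμ hγ'
  set Q := poissonLaw r ν with hQ
  have hξF : Measurable ξ := hξ.mono hG le_rfl
  let V : ℝ × (ℕ → ℕ × (ℕ → Ioi (0 : ℝ) × Ioi (0 : ℝ))) → ℝ := fun q => -β * q.1 + W q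
  have hV : Measurable V := (measurable_fst.const_mul (-β)).add hWm
  let ψ : ℝ → ℝ := fun l => β * l + ∫ z : Ioi (0 : ℝ), expRemainder (l * z) ∂γ
  have hVlap : ∀ x, 0 ≤ x → ∀ l, 0 ≤ l → ∫⁻ s, ENNReal.ofReal (Real.exp (-l * V (x, s))) ∂Q =
      ENNReal.ofReal (Real.exp (x * ψ l)) := fun x hx l hl => by
    have h : ∀ s, ENNReal.ofReal (Real.exp (-l * V (x, s))) = ENNReal.ofReal
        (Real.exp (l * β * x)) * ENNReal.ofReal (Real.exp (-l * W (x, s))) := fun s => by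
      rw [← ENNReal.ofReal_mul (Real.exp_pos _).le, ← Real.exp_add]
      congr 2
      simp only [V]
      ring
    simp only [h]
    rw [lintegral_const_mul' _ _ ENNReal.ofReal_ne_top, hWlap x hx l hl,
      ← ENNReal.ofReal_mul (Real.exp_pos _).le, ← Real.exp_add]
    congr 2
    simp only [ψ]
    ring
  have hlap : ∀ A, MeasurableSet[G] A → ∀ l : ℝ, 0 ≤ l →
      ∫⁻ ω in A, ENNReal.ofReal (Real.exp (-l * Z ω)) ∂P =
        ∫⁻ ω in A, ENNReal.ofReal (Real.exp (ξ ω * ψ l)) ∂P := fun A hA l hl => by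
    rw [← setLIntegral_condLExp hG P _ hA]
    refine lintegral_congr_ae (ae_restrict_of_ae ((hZG l hl).mono fun ω hω => hω.trans ?_))
    simp only [ψ, expRemainder, neg_mul]
  obtain ⟨κ, hκ, hcoup⟩ := exists_kernel_compProd_eq hG hξ hξ0 hZ hV hlap hVlap
  -- an event that has full measure for every fixed height `x` has full measure at `x = ξ`
  have hae : ∀ T : Set ((ℝ × ℝ) × (ℕ → ℕ × (ℕ → Ioi (0 : ℝ) × Ioi (0 : ℝ)))), MeasurableSet T →
      (∀ x, 0 ≤ x → ∀ᵐ s ∂Q, ((x, V (x, s)), s) ∈ T) →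
      ∀ᵐ q ∂(P ⊗ₘ κ), ((ξ q.1, Z q.1), q.2) ∈ T := fun T hT h => by
    have h1 := hcoup univ MeasurableSet.univ Tᶜ hT.compl
    rw [preimage_univ, univ_inter] at h1
    refine ae_iff.2 (h1.trans ?_)
    exact (lintegral_congr fun ω => ae_iff.1 (h (ξ ω) (hξ0 ω))).trans lintegral_zero
  -- the resampled point still has law `Q`, so that it codes a Poisson random measure
  have hsnd : MeasurePreserving (Prod.snd : Ω × (ℕ → ℕ × (ℕ → Ioi (0 : ℝ) × Ioi (0 : ℝ))) → _)
      (P ⊗ₘ κ) Q := by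
    refine ⟨measurable_snd, Measure.ext fun C hC => ?_⟩
    have h1 := hcoup univ MeasurableSet.univ (Prod.snd ⁻¹' C) (measurable_snd hC)
    rw [preimage_univ, univ_inter] at h1
    rw [Measure.map_apply measurable_snd hC]
    refine h1.trans ?_
    change ∫⁻ ω in univ, Q C ∂P = Q C
    simp
  have htrunc : ∀ ε, 0 < ε → ∀ q : Ω × (ℕ → ℕ × (ℕ → Ioi (0 : ℝ) × Ioi (0 : ℝ))),
      truncatedCompensatedIntegral (fun q : Ω × (ℕ → ℕ × (ℕ → Ioi (0 : ℝ) × Ioi (0 : ℝ))) =>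
        pointMeasure q.2) (γ.prod lebesguePos)
        (fun ω p => if (p.2 : ℝ) ≤ ξ ω.1 then (p.1 : ℝ) else 0) ε q =
      truncatedJumpIntegral γ ε (ξ q.1) q.2 := fun ε hε q => by
    rw [truncatedCompensatedIntegral, truncatedJumpIntegral, compensated,
      ← integral_indicator (measurableSet_abs_gt ε (ξ q.1)),
      ← integral_indicator (measurableSet_abs_gt ε (ξ q.1)), indicator_abs_gt_eq_cutoffJump hε]
  refine ⟨ℕ → ℕ × (ℕ → Ioi (0 : ℝ) × Ioi (0 : ℝ)), inferInstance, κ, hκ,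
    fun q => pointMeasure q.2, fun q => W (ξ q.1, q.2), ?_, ?_, ⟨fun ε hε => ?_, ?_⟩, ?_⟩
  · rw [← hμ]
    exact isPoissonRandomMeasure_pointMeasure r ν hsnd
  · rw [Indep_iff]
    rintro _ _ ⟨C, hC, rfl⟩ ⟨A, hA, rfl⟩
    have hC' := measurable_pointMeasure hC
    have h1 := hcoup A hA (Prod.snd ⁻¹' (pointMeasure ⁻¹' C)) (measurable_snd hC')
    have h2 : (P ⊗ₘ κ) (Prod.fst ⁻¹' A) = P A := by
      rw [← Measure.fst_apply (hG A hA), Measure.fst_compProd]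
    have h3 := hsnd.measure_preimage hC'.nullMeasurableSet
    rw [inter_comm, h2]
    refine h1.trans ?_
    change ∫⁻ ω in A, Q (pointMeasure ⁻¹' C) ∂P =
      (P ⊗ₘ κ) (Prod.snd ⁻¹' (pointMeasure ⁻¹' C)) * P A
    rw [h3, lintegral_const, Measure.restrict_apply_univ]
  · have hcut : ∀ x, Integrable (cutoffJump {z | ε < (z : ℝ)} x) (γ.prod lebesguePos) := fun x =>
      integrable_cutoffJump (measurableSet_lt_coe ε) x (integrableOn_tail hγ' hε)
    have hproj : Measurable fun t : (ℝ × ℝ) × (ℕ → ℕ × (ℕ → Ioi (0 : ℝ) × Ioi (0 : ℝ))) =>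
        (t.1.1, t.2) := by fun_prop
    have hT := measurableSet_lt (measurable_lintegral_cutoffJump (measurableSet_lt_coe ε))
      (measurable_const (a := ∞))
    have hfin := hae _ (hproj hT)
      fun x hx => (ae_integrable_pointMeasure r ν (measurable_cutoffJump (measurableSet_lt_coe ε) x)
        (hμ ▸ hcut x)).mono fun s hs => hs.lintegral_lt_top
    filter_upwards [hfin] with q hq
    rw [← integrable_indicator_iff (measurableSet_abs_gt ε (ξ q.1)),
      ← integrable_indicator_iff (measurableSet_abs_gt ε (ξ q.1)),
      indicator_abs_gt_eq_cutoffJump hε]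
    refine ⟨(lintegral_ofReal_ne_top_iff_integrable
      (measurable_cutoffJump (measurableSet_lt_coe ε) _).aestronglyMeasurable
      (ae_of_all _ fun p => cutoffJump_nonneg _ _ p)).1 (ne_of_lt hq), hcut _⟩
  · rw [tendstoInMeasure_iff_norm]
    intro δ hδ
    have hmT : ∀ ε, MeasurableSet {t : (ℝ × ℝ) × (ℕ → ℕ × (ℕ → Ioi (0 : ℝ) × Ioi (0 : ℝ))) |
        δ ≤ |truncatedJumpIntegral γ ε t.1.1 t.2 - W (t.1.1, t.2)|} := fun ε => by
      have hproj : Measurable fun t : (ℝ × ℝ) × (ℕ → ℕ × (ℕ → Ioi (0 : ℝ) × Ioi (0 : ℝ))) =>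
          (t.1.1, t.2) := by fun_prop
      exact measurableSet_le measurable_const
        (((measurable_truncatedJumpIntegral ε).comp hproj).sub (hWm.comp hproj)).abs
    have hlim : Tendsto (fun ε => ∫⁻ ω, Q {s | δ ≤ |truncatedJumpIntegral γ ε (ξ ω) s -
        W (ξ ω, s)|} ∂P) (𝓝[>] 0) (𝓝 (∫⁻ _, 0 ∂P)) := by
      refine tendsto_lintegral_filter_of_dominated_convergence (fun _ => 1)
        (Eventually.of_forall fun ε => ?_) (Eventually.of_forall fun ε => ae_of_all _ fun ω =>
          prob_le_one) (by simp) (ae_of_all _ fun ω => hWlim (ξ ω) (hξ0 ω) δ hδ)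
      have hproj : Measurable fun t : Ω × (ℕ → ℕ × (ℕ → Ioi (0 : ℝ) × Ioi (0 : ℝ))) =>
          (ξ t.1, t.2) := by fun_prop
      exact measurable_measure_prodMk_left (measurableSet_le measurable_const
        (((measurable_truncatedJumpIntegral ε).comp hproj).sub (hWm.comp hproj)).abs)
    rw [lintegral_zero] at hlim
    refine hlim.congr' ?_
    filter_upwards [self_mem_nhdsWithin] with ε hε
    have h1 := hcoup univ MeasurableSet.univ _ (hmT ε)
    rw [preimage_univ, univ_inter, Measure.restrict_univ] at h1
    simp only [htrunc ε hε]
    exact h1.symm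
  · exact hae {t | t.1.2 = -β * t.1.1 + W (t.1.1, t.2)}
      (measurableSet_eq_fun (by fun_prop) (by fun_prop)) fun x _ => ae_of_all _ fun s => rfl
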